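/- Let $G$ be a countable discrete amenable group: for every nonempty finite $K\subseteq G$ and every $\delta>0$ there is a nonempty finite $F\subseteq G$ with $|KF\,\triangle\,F|<\delta|F|$. Let $X=\mathbb{N}^G$, with $\mathbb{N}=\{0,1,2,\dots\}$, carry the product $\sigma$-algebra $\mathcal{B}$ and the action $(g\cdot x)(h)=x(hg)$ of $G$. For $S\subseteq G$ let $x_S$ be the restriction of $x$ to $S$ and let $\mathcal{B}_S$ be the $\sigma$-algebra generated by the coordinates in $S$; for finite $F$ and $w\in\mathbb{N}^F$ let $[w]=\{x: x_F=w\}$, and let $w x_{F^c}$ be the configuration equal to $w$ on $F$ and to $x$ off $F$. Let $\{E_m\}_{m\ge 0}$ be an exhausting sequence: finite sets $E_0=\emptyset$, $E_1=\{1_G\}$, $E_m\subseteq E_{m+1}$, $\bigcup_m E_m=G$. For a potential $\phi\colon X\to\mathbb{R}$ put $\phi_F(x)=\sum_{g\in F}\phi(g\cdot x)$ and $\delta_E(\phi)=\sup\{|\phi(x)-\phi(y)|: x_E=y_E\}$. Suppose that $\phi$ is exp-summable and has summable variation according to $\{E_m\}$, that is, $$\sum_{w\in\mathbb{N}^{\{1_G\}}}\exp\bigl(\sup\phi([w])\bigr)<\infty,\qquad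 \sum_{m\ge 1}\bigl|E_{m+1}^{-1}\setminus E_m^{-1}\bigr|\,\delta_{E_m}(\phi)<\infty .$$ A probability measure $\mu$ on $(X,\mathcal{B})$ is a DLR measure for $\phi$ if for every nonempty finite $K\subseteq G$ and every $B\in\mathcal{B}$ the limit $$\gamma_K(B,x)=\lim_{m\to\infty}\frac{\sum_{w\in\mathbb{N}^K}\exp(\phi_{E_m}(w x_{K^c}))\,\mathbf 1_{\{w x_{K^c}\in B\}}}{\sum_{v\in\mathbb{N}^K}\exp(\phi_{E_m}(v x_{K^c}))}$$ exists for every $x\in X$, and $\mu(B\mid\mathcal{B}_{K^c})(x)=\gamma_K(B,x)$ for $\mu$-almost every $x$. It is a conformal measure for $\phi$ if, for all nonempty finite $A\subset\mathbb{N}$ and $K\subseteq G$ and every map $\tau\colon X\to X$ that applies at each site $g\in K$ a permutation $\tau_g$ of $\mathbb{N}$ fixing all symbols outside $A$ and leaves the sites outside $K$ unchanged, the uniform limit $\phi_*^\tau=\lim_{m\to\infty}(\phi_{E_m}\circ\tau^{-1}-\phi_{E_m})$ exists and $\mu\circ\tau^{-1}$ has density $\exp(\phi_*^\tau)$ with respect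 to $\mu$. Then there exists a $G$-invariant probability measure on $X$ that is a DLR measure for $\phi$. Moreover, a probability measure on $X$ is a DLR measure for $\phi$ if and only if it is a conformal measure for $\phi$; so, equivalently, there exists a $G$-invariant conformal measure for $\phi$. -/

import Mathlib

open MeasureTheory Filter Topology ProbabilityTheory
open scoped ENNReal Pointwise

namespace GibbsShift

/-- `F` is `(K, δ)`-invariant: `|K F ∆ F| < δ |F|`. -/
def IsInvariantSet {G : Type*} [Group G] (K F : Finset G) (δ : ℝ) : Prop :=
  open Classical in ((symmDiff (K * F) F).card : ℝ) < δ * (F.card : ℝ)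

/-- Amenability: for every nonempty finite `K` and every `δ > 0` there is a nonempty finite
`(K, δ)`-invariant set. -/
def IsAmenable (G : Type*) [Group G] : Prop :=
  ∀ K : Finset G, K.Nonempty → ∀ δ : ℝ, 0 < δ →
    ∃ F : Finset G, F.Nonempty ∧ IsInvariantSet K F δ

/-- Exhausting sequences `∅ = E₀ ⊆ {1} = E₁ ⊆ E₂ ⊆ ⋯` of finite sets with union `G`.
Strict inclusions are not required, so that finite groups also have such sequences. -/
structure IsExhaustion {G : Type*} [Group G] (E : ℕ → Finset G) : Prop where
  zero : E 0 = ∅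
  one : E 1 = {1}
  mono : Monotone E
  exhausts : ∀ g : G, ∃ m, g ∈ E m

/-- The translation action on configurations, `(g · x)(h) = x(hg)`. -/
def shift {G : Type*} [Group G] (g : G) (x : G → ℕ) : G → ℕ := fun h => x (h * g)

/-- The cylinder set `[w]` of configurations which agree with `w` on `F`. -/
def cyl {G : Type*} (F : Finset G) (w : F → ℕ) : Set (G → ℕ) :=
  {x | ∀ g : F, x g = w g}

/-- The configuration `w x_{Kᶜ}`, equal to `w` on `K` and to `x` outside `K`. -/
noncomputable def splice {G : Type*} (K : Finset G) (w : K → ℕ) (x : G → ℕ) : G → ℕ :=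
  open Classical in fun g => if h : g ∈ K then w ⟨g, h⟩ else x g

/-- `φ_F(x) = ∑_{g ∈ F} φ(g · x)`. -/
def energy {G : Type*} [Group G] (φ : (G → ℕ) → ℝ) (F : Finset G) (x : G → ℕ) : ℝ :=
  ∑ g ∈ F, φ (shift g x)

/-- The variation `δ_E(φ) = sup {|φ(x) - φ(y)| : x_E = y_E}`, possibly infinite. -/
noncomputable def variation {G : Type*} (φ : (G → ℕ) → ℝ) (E : Finset G) : ℝ≥0∞ :=
  ⨆ (x : G → ℕ) (y : G → ℕ) (_ : ∀ g ∈ E, x g = y g), ENNReal.ofReal |φ x - φ y|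

/-- `V(φ) = ∑_{m ≥ 1} |E_{m+1}⁻¹ \ E_m⁻¹| δ_{E_m}(φ) < ∞`
(the summation index below is `m - 1`). -/
def HasSummableVariation {G : Type*} [Group G] (E : ℕ → Finset G) (φ : (G → ℕ) → ℝ) : Prop :=
  open Classical in
  ∑' m : ℕ, (((E (m + 2))⁻¹ \ (E (m + 1))⁻¹).card : ℝ≥0∞) * variation φ (E (m + 1)) < ∞

/-- The partition function `Z_F(φ) = ∑_{w ∈ ℕ^F} exp (sup φ_F([w]))`, possibly infinite. -/
noncomputable def partitionFunction {G : Type*} [Group G] (φ : (G → ℕ) → ℝ) (F : Finset G) :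
    ℝ≥0∞ :=
  ∑' w : F → ℕ, EReal.exp (⨆ x ∈ cyl F w, (energy φ F x : EReal))

/-- `φ` is exp-summable: `Z_{{1}}(φ) < ∞`. -/
def IsExpSummable {G : Type*} [Group G] (φ : (G → ℕ) → ℝ) : Prop :=
  partitionFunction φ {1} < ∞

/-- The ratio
`∑_w exp(φ_F(w x_{Kᶜ})) 1_{w x_{Kᶜ} ∈ B} / ∑_v exp(φ_F(v x_{Kᶜ}))`, sums over `ℕ^K`. -/
noncomputable def gibbsRatio {G : Type*} [Group G] (φ : (G → ℕ) → ℝ) (F K : Finset G)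
    (B : Set (G → ℕ)) (x : G → ℕ) : ℝ≥0∞ :=
  (∑' w : K → ℕ, B.indicator (fun y => ENNReal.ofReal (Real.exp (energy φ F y))) (splice K w x)) /
    ∑' v : K → ℕ, ENNReal.ofReal (Real.exp (energy φ F (splice K v x)))

/-- `γ` is the Gibbsian specification of `φ`: the limit
`γ_K(B, x) = lim_m (gibbsRatio of φ_{E_m})` exists for all `K`, `B` and `x`. This determines
`γ_K(B, x)` for all nonempty finite `K`, all Borel sets `B` and all `x`. -/
def IsGibbsSpecification {G : Type*} [Group G] (E : ℕ → Finset G) (φ : (G → ℕ) → ℝ)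
    (γ : Finset G → Set (G → ℕ) → (G → ℕ) → ℝ≥0∞) : Prop :=
  ∀ K : Finset G, K.Nonempty → ∀ B : Set (G → ℕ), MeasurableSet B → ∀ x : G → ℕ,
    Tendsto (fun m => gibbsRatio φ (E m) K B x) atTop (𝓝 (γ K B x))

/-- DLR measures: `μ(B | 𝓑_{Kᶜ}) = γ_K(B, ·)` almost surely, where `𝓑_{Kᶜ}` is generated by the
coordinates outside `K`. -/
def IsDLR {G : Type*} [Group G] (E : ℕ → Finset G) (φ : (G → ℕ) → ℝ)
    (μ : Measure (G → ℕ)) : Prop :=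
  ∃ γ : Finset G → Set (G → ℕ) → (G → ℕ) → ℝ≥0∞, IsGibbsSpecification E φ γ ∧
    ∀ K : Finset G, K.Nonempty → ∀ B : Set (G → ℕ), MeasurableSet B →
      μ⟦B | cylinderEvents (X := fun _ : G => ℕ) ((K : Set G)ᶜ)⟧
        =ᵐ[μ] fun x => (γ K B x).toReal

/-- The set `𝓔_{K,A}` of coordinate-wise permutations acting on the sites of `K` by
permutations of `ℕ` which fix every symbol outside `A`. -/
def coordPerms {G : Type*} (K : Finset G) (A : Finset ℕ) : Set ((G → ℕ) ≃ (G → ℕ)) :=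
  {τ | ∃ σ : G → Equiv.Perm ℕ, (∀ g ∈ K, ∀ a ∉ A, σ g a = a) ∧
    ∀ x : G → ℕ, (∀ g ∈ K, τ x g = σ g (x g)) ∧ ∀ g ∉ K, τ x g = x g}

/-- Conformal measures: `d(μ ∘ τ⁻¹)/dμ = exp(φ_*^τ)` for every `τ ∈ 𝓔_{K,A}`, where
`φ_*^τ` is the uniform limit of `φ_{E_m} ∘ τ⁻¹ - φ_{E_m}`. -/
def IsConformal {G : Type*} [Group G] (E : ℕ → Finset G) (φ : (G → ℕ) → ℝ)
    (μ : Measure (G → ℕ)) : Prop :=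
  ∀ A : Finset ℕ, A.Nonempty → ∀ K : Finset G, K.Nonempty → ∀ τ ∈ coordPerms K A,
    ∃ φstar : (G → ℕ) → ℝ,
      TendstoUniformly (fun m x => energy φ (E m) (τ.symm x) - energy φ (E m) x) φstar atTop ∧
      μ.map τ = μ.withDensity (fun x => ENNReal.ofReal (Real.exp (φstar x)))

/-- `G`-invariance of a measure on `ℕ^G`. -/
def IsShiftInvariant {G : Type*} [Group G] (μ : Measure (G → ℕ)) : Prop :=
  ∀ g : G, μ.map (shift g) = μ

end GibbsShift

/-! If `y` and `z` differ only on a finite set `K`, summable variation makes the total energy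
difference `cocycle φ y z` absolutely convergent. A change on `K` is first seen by `g · x` in the
window `E_n` that meets `K g⁻¹`, and counting such `g` gives a bound proportional to `|K|`. With
exp-summability, the weights `exp (cocycle ..)` of patterns on `K` have a summable majorant that
factorizes over sites. So the limits defining `γ_K` exist by dominated convergence and equal an
explicit kernel `gibbsKernel`.

Both notions of Gibbs measure reduce to invariance under these kernels. DLR is invariance plus
dependence on the boundary alone (`isDLR_iff`). A kernel is conformal because permuting patterns
reindexes its sum. Conversely, conformality under the exchange of two patterns is a detailed balance
relation, which sums to invariance (`isGibbsInvariantOn_of_isConformalOn`).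

For existence, average over a Følner set `F_n` the translates of a finite-volume kernel on `E_{n+1}
F_n`. The region is large enough for each translate to be conformal on every `K ⊆ E_{n+1}`.
Exchanging a symbol with `0` bounds one-site probabilities uniformly, which gives tightness.
Densities `exp (cocycle ..)` are bounded and continuous, so conformality survives weak limits; the
Følner property makes the limit invariant. -/

namespace GibbsShift

/-! ### Consequences of exp-summability and summable variation. -/

section Regularity

section

variable {G : Type*}

lemma ofReal_abs_sub_le_variation (φ : (G → ℕ) → ℝ) {F : Finset G} {x y : G → ℕ}
    (h : ∀ g ∈ F, x g = y g) : ENNReal.ofReal |φ x - φ y| ≤ variation φ F :=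
  le_iSup_of_le x (le_iSup_of_le y (le_iSup_of_le h le_rfl))

lemma abs_sub_le_toReal_variation (φ : (G → ℕ) → ℝ) {F : Finset G} (hF : variation φ F ≠ ∞)
    {x y : G → ℕ} (h : ∀ g ∈ F, x g = y g) : |φ x - φ y| ≤ (variation φ F).toReal :=
  (ENNReal.ofReal_le_iff_le_toReal hF).1 (ofReal_abs_sub_le_variation φ h)

lemma variation_eq_zero_of_forall_mem (φ : (G → ℕ) → ℝ) {F : Finset G} (hF : ∀ g, g ∈ F) :
    variation φ F = 0 := by
  simp only [variation, ENNReal.iSup_eq_zero]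
  intro x y h
  have : x = y := funext fun g => h g (hF g)
  simp [this]

end

variable {G : Type*} [Group G]

/-- The consequences of exp-summability and summable variation used below: continuity, bounded
oscillation on the cylinders over `1`, summable oscillation under changes in a finite set, and
summability of `exp φ` over the constant configurations. -/
structure IsRegularPotential (φ : (G → ℕ) → ℝ) (D V : ℝ) : Prop where
  continuous : Continuous φ
  abs_sub_le : ∀ y z : G → ℕ, y 1 = z 1 → |φ y - φ z| ≤ D
  oscillation : ∀ K : Finset G, ∃ b : G → ℝ, Summable b ∧ (∀ g, 0 ≤ b g) ∧
    ∑' g, b g ≤ K.card * V ∧ ∀ g ∉ K, ∀ y z : G → ℕ, (∀ i ∉ K, y i = z i) →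
      |φ (shift g y) - φ (shift g z)| ≤ b g
  tsum_exp : ∑' a : ℕ, ENNReal.ofReal (Real.exp (φ fun _ => a)) < ∞

/-- As inclusions need not be strict, the weight of `δ_{E_m}` in the variation sum may vanish. The
next strict inclusion has the same set `E_m` and a nonzero weight. -/
lemma IsExhaustion.all_mem_or_exists_jump {E : ℕ → Finset G} (hE : IsExhaustion E) (m : ℕ) :
    (∀ g, g ∈ E m) ∨ ∃ k, m ≤ k ∧ E k = E m ∧ ∃ g ∈ E (k + 1), g ∉ E k := by
  classical
  by_cases h : ∀ g, g ∈ E m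
  · exact Or.inl h
  · right
    push Not at h
    obtain ⟨g, hg⟩ := h
    have hex : ∃ n, ∃ g ∈ E n, g ∉ E m := by
      obtain ⟨n, hn⟩ := hE.exhausts g
      exact ⟨n, g, hn, hg⟩
    obtain ⟨g', hg', hgm⟩ := Nat.find_spec hex
    have hlt : m < Nat.find hex := by
      by_contra hle
      exact hgm (hE.mono (not_lt.1 hle) hg')
    obtain ⟨k, hk⟩ : ∃ k, Nat.find hex = k + 1 := ⟨Nat.find hex - 1, by omega⟩
    have hkm : E k = E m := by
      apply le_antisymm
      · intro a ha
        by_contra hb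
        exact Nat.find_min hex (show k < Nat.find hex by omega) ⟨a, ha, hb⟩
      · exact hE.mono (by omega)
    exact ⟨k, by omega, hkm, g', hk ▸ hg', hkm ▸ hgm⟩

lemma variation_le_of_summable {E : ℕ → Finset G} (hE : IsExhaustion E) (φ : (G → ℕ) → ℝ)
    {m : ℕ} (hm : 1 ≤ m) (hne : ¬ ∀ g, g ∈ E m) :
    open Classical in
    ∃ j, m ≤ j + 1 ∧ variation φ (E m) ≤
      (((E (j + 2))⁻¹ \ (E (j + 1))⁻¹).card : ℝ≥0∞) * variation φ (E (j + 1)) := by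
  classical
  obtain h | ⟨k, hmk, hk, g, hg, hg'⟩ := hE.all_mem_or_exists_jump m
  · exact absurd h hne
  · obtain ⟨j, rfl⟩ : ∃ j, k = j + 1 := ⟨k - 1, by omega⟩
    refine ⟨j, hmk, ?_⟩
    rw [hk]
    have : (1 : ℝ≥0∞) ≤ (((E (j + 2))⁻¹ \ (E m)⁻¹).card : ℝ≥0∞) := by
      have : 0 < ((E (j + 2))⁻¹ \ (E m)⁻¹).card :=
        Finset.card_pos.2 ⟨g⁻¹, by simp [hg, ← hk, hg']⟩
      exact_mod_cast this
    simpa using mul_le_mul_left this (variation φ (E m))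

lemma HasSummableVariation.variation_ne_top {E : ℕ → Finset G} (hE : IsExhaustion E)
    {φ : (G → ℕ) → ℝ} (hV : HasSummableVariation E φ) {m : ℕ} (hm : 1 ≤ m) :
    variation φ (E m) ≠ ∞ := by
  classical
  by_cases h : ∀ g, g ∈ E m
  · simp [variation_eq_zero_of_forall_mem φ h]
  · obtain ⟨j, -, hj⟩ := variation_le_of_summable hE φ hm h
    refine ne_top_of_le_ne_top ?_ hj
    convert ENNReal.ne_top_of_tsum_ne_top hV.ne j

lemma HasSummableVariation.exists_variation_le {E : ℕ → Finset G} (hE : IsExhaustion E)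
    {φ : (G → ℕ) → ℝ} (hV : HasSummableVariation E φ) {ε : ℝ≥0∞} (hε : 0 < ε) :
    ∃ m, variation φ (E m) ≤ ε := by
  classical
  have ht := ENNReal.tendsto_cofinite_zero_of_tsum_ne_top hV.ne
  rw [Nat.cofinite_eq_atTop] at ht
  obtain ⟨N, hN⟩ := (eventually_atTop.1 (ht.eventually_le_const hε))
  refine ⟨N + 1, ?_⟩
  by_cases h : ∀ g, g ∈ E (N + 1)
  · simp [variation_eq_zero_of_forall_mem φ h]
  · obtain ⟨j, hj', hj⟩ := variation_le_of_summable hE φ (by omega) h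
    refine hj.trans ?_
    convert hN j (by omega)

lemma HasSummableVariation.continuous {E : ℕ → Finset G} (hE : IsExhaustion E)
    {φ : (G → ℕ) → ℝ} (hV : HasSummableVariation E φ) : Continuous φ := by
  rw [continuous_iff_continuousAt]
  intro x
  rw [ContinuousAt, Metric.tendsto_nhds]
  intro ε hε
  obtain ⟨m, hm⟩ := hV.exists_variation_le hE (ε := ENNReal.ofReal (ε / 2)) (by simpa using hε)
  have hev : ∀ᶠ y in 𝓝 x, ∀ g ∈ E m, y g = x g := by
    rw [Filter.eventually_all_finset]
    intro g _
    have : ContinuousAt (fun y : G → ℕ => y g) x := (continuous_apply g).continuousAt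
    exact this.eventually (mem_nhds_discrete.2 rfl : {a | a = x g} ∈ 𝓝 (x g))
  filter_upwards [hev] with y hy
  rw [Real.dist_eq]
  have := (ofReal_abs_sub_le_variation φ hy).trans hm
  rw [ENNReal.ofReal_le_ofReal_iff (by positivity)] at this
  linarith

lemma tsum_ite_mul_inv_mem (S : Finset G) (k : G) (c : ℝ≥0∞) :
    open Classical in
    ∑' g : G, (if g * k⁻¹ ∈ S then c else 0) = S.card * c := by
  classical
  rw [← (Equiv.mulRight k).tsum_eq]
  simp only [Equiv.coe_mulRight, mul_inv_cancel_right]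
  rw [tsum_eq_sum (s := S) (by simp +contextual)]
  simp [Finset.sum_ite_mem]

/-- The configurations `g · y` and `g · z` can differ only on `K g⁻¹`. If `E_{m+2}` is the first
window to meet `K g⁻¹`, the oscillation is at most `δ_{E_{m+1}}`, and `g k⁻¹ ∈ E_{m+2}⁻¹ \
E_{m+1}⁻¹` for some `k ∈ K`. For fixed `k` and `m` the number of such `g` is exactly the weight in
the variation sum, so summing over `k` gives `|K| V`. -/
lemma HasSummableVariation.exists_oscillation {E : ℕ → Finset G} (hE : IsExhaustion E)
    {φ : (G → ℕ) → ℝ} (hV : HasSummableVariation E φ) :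
    ∃ V : ℝ, ∀ K : Finset G, ∃ b : G → ℝ, Summable b ∧ (∀ g, 0 ≤ b g) ∧
      ∑' g, b g ≤ K.card * V ∧ ∀ g ∉ K, ∀ y z : G → ℕ, (∀ i ∉ K, y i = z i) →
        |φ (shift g y) - φ (shift g z)| ≤ b g := by
  classical
  set v : ℝ≥0∞ :=
    ∑' m : ℕ, (((E (m + 2))⁻¹ \ (E (m + 1))⁻¹).card : ℝ≥0∞) * variation φ (E (m + 1)) with hv
  have hvtop : v ≠ ∞ := by
    have := hV.ne
    rw [hv]; convert this
  refine ⟨v.toReal, fun K => ?_⟩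
  set B : G → ℝ≥0∞ := fun g => ∑ k ∈ K, ∑' m : ℕ,
    if g * k⁻¹ ∈ (E (m + 2))⁻¹ \ (E (m + 1))⁻¹ then variation φ (E (m + 1)) else 0 with hB
  have hsum : ∑' g, B g = K.card * v := by
    rw [hB, Summable.tsum_finsetSum (fun _ _ => ENNReal.summable)]
    have : ∀ k ∈ K, ∑' g : G, ∑' m : ℕ, (if g * k⁻¹ ∈ (E (m + 2))⁻¹ \ (E (m + 1))⁻¹ then
        variation φ (E (m + 1)) else 0) = v := by
      intro k _
      rw [ENNReal.tsum_comm, hv]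
      congr 1
      ext m
      convert tsum_ite_mul_inv_mem ((E (m + 2))⁻¹ \ (E (m + 1))⁻¹) k (variation φ (E (m + 1)))
    rw [Finset.sum_congr rfl this]
    simp
  have hBtop : ∑' g, B g ≠ ∞ := by
    rw [hsum]; exact ENNReal.mul_ne_top (by simp) hvtop
  have hBg := ENNReal.ne_top_of_tsum_ne_top hBtop
  refine ⟨fun g => (B g).toReal, ENNReal.summable_toReal hBtop, fun _ => ENNReal.toReal_nonneg,
    ?_, ?_⟩
  · rw [← ENNReal.tsum_toReal_eq hBg, hsum]
    simp
  · intro g hg y z hyz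
    by_cases hK : K.Nonempty
    swap
    · have : y = z := funext fun i => hyz i (by
        rw [Finset.not_nonempty_iff_eq_empty] at hK; simp [hK])
      simp [this]
    have hex : ∃ n, ∃ k ∈ K, k * g⁻¹ ∈ E n := by
      obtain ⟨k, hk⟩ := hK
      obtain ⟨n, hn⟩ := hE.exhausts (k * g⁻¹)
      exact ⟨n, k, hk, hn⟩
    obtain ⟨k, hk, hkn⟩ := Nat.find_spec hex
    have hmin := fun i => @Nat.find_min _ _ hex i
    generalize Nat.find hex = n at hkn hmin
    -- The first meeting index is at least 2: `E_0` is empty, and meeting `E_1 = {1}` would put `g`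
    -- in `K`.
    obtain rfl | rfl | ⟨m, rfl⟩ : n = 0 ∨ n = 1 ∨ ∃ m, n = m + 2 := by
      rcases n with _ | _ | n
      · simp
      · simp
      · exact Or.inr (Or.inr ⟨n, rfl⟩)
    · simp [hE.zero] at hkn
    · rw [hE.one, Finset.mem_singleton, mul_inv_eq_one] at hkn
      exact absurd (hkn ▸ hk) hg
    · rw [← ENNReal.ofReal_le_iff_le_toReal (hBg g)]
      have hagree : ∀ h ∈ E (m + 1), shift g y h = shift g z h := by
        intro h hh
        apply hyz
        intro hc
        exact hmin (m + 1) (by omega) ⟨h * g, hc, by simpa using hh⟩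
      refine (ofReal_abs_sub_le_variation φ hagree).trans ?_
      have hmem : g * k⁻¹ ∈ (E (m + 2))⁻¹ \ (E (m + 1))⁻¹ := by
        simp only [Finset.mem_sdiff, Finset.mem_inv', mul_inv_rev, inv_inv]
        exact ⟨hkn, fun hc => hmin (m + 1) (by omega) ⟨k, hk, hc⟩⟩
      calc variation φ (E (m + 1))
          = if g * k⁻¹ ∈ (E (m + 2))⁻¹ \ (E (m + 1))⁻¹ then variation φ (E (m + 1)) else 0 := by
            rw [if_pos hmem]
        _ ≤ ∑' m : ℕ, if g * k⁻¹ ∈ (E (m + 2))⁻¹ \ (E (m + 1))⁻¹ then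
              variation φ (E (m + 1)) else 0 :=
            ENNReal.le_tsum (f := fun m => if g * k⁻¹ ∈ (E (m + 2))⁻¹ \ (E (m + 1))⁻¹ then
              variation φ (E (m + 1)) else 0) m
        _ ≤ B g := Finset.single_le_sum (f := fun k => ∑' m : ℕ,
            if g * k⁻¹ ∈ (E (m + 2))⁻¹ \ (E (m + 1))⁻¹ then variation φ (E (m + 1)) else 0)
            (fun _ _ => zero_le) hk

lemma shift_one (x : G → ℕ) : shift 1 x = x := by
  ext; simp [shift]

/-- The constant configuration `a` lies in the cylinder of the symbol `a`. It serves from here on as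
a representative of that symbol in place of the supremum. -/
lemma IsExpSummable.tsum_exp_const_lt_top {φ : (G → ℕ) → ℝ} (hφ : IsExpSummable φ) :
    ∑' a : ℕ, ENNReal.ofReal (Real.exp (φ fun _ => a)) < ∞ := by
  refine lt_of_le_of_lt ?_ hφ
  have hinj : Function.Injective (fun (a : ℕ) (_ : ({1} : Finset G)) => a) := by
    intro a b h
    exact congrFun h ⟨1, by simp⟩
  rw [partitionFunction]
  refine le_trans ?_ (ENNReal.tsum_comp_le_tsum_of_injective hinj _)
  refine ENNReal.tsum_le_tsum fun a => ?_
  rw [← EReal.exp_coe]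
  apply EReal.exp_monotone
  refine le_iSup₂_of_le (fun _ => a) (fun _ => rfl) ?_
  simp [energy, shift_one]

theorem exists_isRegularPotential {E : ℕ → Finset G} (hE : IsExhaustion E) {φ : (G → ℕ) → ℝ}
    (hφ : IsExpSummable φ) (hV : HasSummableVariation E φ) :
    ∃ D V, IsRegularPotential φ D V := by
  obtain ⟨V, hVb⟩ := hV.exists_oscillation hE
  refine ⟨(variation φ (E 1)).toReal, V, hV.continuous hE, fun y z h => ?_, hVb, hφ.tsum_exp_const_lt_top⟩
  exact abs_sub_le_toReal_variation φ (hV.variation_ne_top hE le_rfl) (by simpa [hE.one] using h)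

end Regularity

/-! ### Finite changes of configurations and the energy cocycle. -/

section Cocycle

section Sites

variable {G : Type*}

lemma splice_of_mem {K : Finset G} (w : K → ℕ) (x : G → ℕ) {g : G} (hg : g ∈ K) :
    splice K w x g = w ⟨g, hg⟩ := by
  simp [splice, hg]

lemma splice_of_notMem {K : Finset G} (w : K → ℕ) (x : G → ℕ) {g : G} (hg : g ∉ K) :
    splice K w x g = x g := by
  simp [splice, hg]

lemma splice_splice (K : Finset G) (v w : K → ℕ) (x : G → ℕ) :
    splice K v (splice K w x) = splice K v x := by
  ext g
  by_cases hg : g ∈ K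
  · simp [splice_of_mem, hg]
  · simp [splice_of_notMem, hg]

lemma splice_eq_self {K : Finset G} {w : K → ℕ} {x : G → ℕ} (hx : x ∈ cyl K w) :
    splice K w x = x := by
  ext g
  by_cases hg : g ∈ K
  · simpa [splice_of_mem, hg] using (hx ⟨g, hg⟩).symm
  · simp [splice_of_notMem, hg]

lemma continuous_splice (K : Finset G) (w : K → ℕ) : Continuous (splice K w) := by
  refine continuous_pi fun g => ?_
  by_cases hg : g ∈ K
  · simpa [splice_of_mem, hg] using continuous_const
  · simpa [splice_of_notMem, hg] using continuous_apply g

lemma apply_eq_of_mem_coordPerms {K : Finset G} {A : Finset ℕ} {τ : (G → ℕ) ≃ (G → ℕ)}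
    (hτ : τ ∈ coordPerms K A) (x : G → ℕ) {g : G} (hg : g ∉ K) : τ x g = x g := by
  obtain ⟨σ, -, h⟩ := hτ
  exact (h x).2 g hg

lemma symm_mem_coordPerms {K : Finset G} {A : Finset ℕ} {τ : (G → ℕ) ≃ (G → ℕ)}
    (hτ : τ ∈ coordPerms K A) : τ.symm ∈ coordPerms K A := by
  obtain ⟨σ, hσ, h⟩ := hτ
  refine ⟨fun g => (σ g)⁻¹, fun g hg a ha => ?_, fun x => ⟨fun g hg => ?_, fun g hg => ?_⟩⟩
  · rw [Equiv.Perm.inv_eq_iff_eq, hσ g hg a ha]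
  · rw [eq_comm, Equiv.Perm.inv_eq_iff_eq, ← (h _).1 g hg, Equiv.apply_symm_apply]
  · simpa using ((h (τ.symm x)).2 g hg).symm

lemma coordPerms_mono {K H : Finset G} (hKH : K ⊆ H) (A : Finset ℕ) :
    coordPerms K A ⊆ coordPerms H A := by
  classical
  rintro τ ⟨σ, hσ, h⟩
  -- Off `K` the family `σ` is unconstrained, so it is replaced by the identity there.
  refine ⟨fun g => if g ∈ K then σ g else 1, fun g _ a ha => ?_, fun x => ⟨fun g _ => ?_,
    fun g hg => (h x).2 g fun hgK => hg (hKH hgK)⟩⟩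
  · by_cases hg : g ∈ K
    · simp [hg, hσ g hg a ha]
    · simp [hg]
  · by_cases hg : g ∈ K
    · simp [hg, (h x).1 g hg]
    · simp [hg, (h x).2 g hg]

lemma continuous_of_mem_coordPerms {K : Finset G} {A : Finset ℕ} {τ : (G → ℕ) ≃ (G → ℕ)}
    (hτ : τ ∈ coordPerms K A) : Continuous τ := by
  obtain ⟨σ, -, h⟩ := hτ
  refine continuous_pi fun g => ?_
  by_cases hg : g ∈ K
  · simp only [(h _).1 g hg]
    exact continuous_of_discreteTopology.comp (continuous_apply g)
  · simpa only [(h _).2 g hg] using continuous_apply g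

/-- The map which exchanges `v g` and `w g` at every site `g ∈ K`. -/
noncomputable def swapSites (K : Finset G) (v w : K → ℕ) : (G → ℕ) ≃ (G → ℕ) :=
  open Classical in
  Equiv.piCongrRight fun g =>
    if h : g ∈ K then Equiv.swap (v ⟨g, h⟩) (w ⟨g, h⟩) else Equiv.refl ℕ

/-- Inserting `0` keeps the alphabet nonempty even when `K` is empty. -/
lemma swapSites_mem_coordPerms (K : Finset G) (v w : K → ℕ) :
    swapSites K v w ∈ coordPerms K (insert 0 (Finset.univ.image v ∪ Finset.univ.image w)) := by
  classical
  refine ⟨fun g => if h : g ∈ K then Equiv.swap (v ⟨g, h⟩) (w ⟨g, h⟩) else Equiv.refl ℕ,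
    fun g hg a ha => ?_, fun x => ⟨fun g hg => rfl, fun g hg => ?_⟩⟩
  · simp only [Finset.mem_insert, Finset.mem_union, Finset.mem_image, Finset.mem_univ, true_and,
      not_or, not_exists] at ha
    simp only [hg, dif_pos]
    exact Equiv.swap_apply_of_ne_of_ne (Ne.symm (ha.2.1 _)) (Ne.symm (ha.2.2 _))
  · simp [swapSites, hg]

lemma swapSites_symm (K : Finset G) (v w : K → ℕ) :
    (swapSites K v w).symm = swapSites K v w := by
  ext x g
  by_cases hg : g ∈ K <;> simp [swapSites, hg]

lemma swapSites_apply_of_mem_cyl {K : Finset G} {v w : K → ℕ} {x : G → ℕ} (hx : x ∈ cyl K w) :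
    swapSites K v w x = splice K v x := by
  ext g
  by_cases hg : g ∈ K
  · have := hx ⟨g, hg⟩
    simp only at this
    simp [swapSites, hg, splice_of_mem, this]
  · simp [swapSites, hg, splice_of_notMem]

lemma swapSites_mem_cyl_iff {K : Finset G} {v w : K → ℕ} {x : G → ℕ} :
    swapSites K v w x ∈ cyl K w ↔ x ∈ cyl K v := by
  refine forall_congr' fun g => ?_
  simp only [swapSites, Equiv.piCongrRight_apply, Pi.map_apply, g.2, dif_pos]
  rw [Equiv.swap_apply_eq_iff, Equiv.swap_apply_right]

end Sites

variable {G : Type*} [Group G]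

lemma shift_shift (g h : G) (x : G → ℕ) : shift g (shift h x) = shift (g * h) x := by
  ext; simp [shift, mul_assoc]

lemma continuous_shift (g : G) : Continuous (shift g : (G → ℕ) → G → ℕ) :=
  continuous_pi fun h => continuous_apply (h * g)

/-- The total energy difference of two configurations. -/
noncomputable def cocycle (φ : (G → ℕ) → ℝ) (y z : G → ℕ) : ℝ :=
  ∑' g, (φ (shift g y) - φ (shift g z))

@[simp]
lemma cocycle_self (φ : (G → ℕ) → ℝ) (y : G → ℕ) : cocycle φ y y = 0 := by
  simp [cocycle]

/-- Right multiplication reindexes the sum over the whole group. -/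
lemma cocycle_shift (φ : (G → ℕ) → ℝ) (g : G) (y z : G → ℕ) :
    cocycle φ (shift g y) (shift g z) = cocycle φ y z := by
  simp only [cocycle, shift_shift]
  exact (Equiv.mulRight g).tsum_eq fun h => φ (shift h y) - φ (shift h z)

lemma energy_sub_energy (φ : (G → ℕ) → ℝ) (F : Finset G) (y z : G → ℕ) :
    energy φ F y - energy φ F z = ∑ g ∈ F, (φ (shift g y) - φ (shift g z)) := by
  simp [energy]

lemma IsExhaustion.tendsto_atTop {E : ℕ → Finset G} (hE : IsExhaustion E) :
    Tendsto E atTop atTop :=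
  tendsto_atTop_finset_of_monotone hE.mono hE.exhausts

namespace IsRegularPotential

variable {φ : (G → ℕ) → ℝ} {D V : ℝ} {K : Finset G} {y z u : G → ℕ}

lemma abs_sub_const_le (hφ : IsRegularPotential φ D V) (g : G) (y : G → ℕ) :
    |φ (shift g y) - φ (fun _ => y g)| ≤ D :=
  hφ.abs_sub_le _ _ (by simp [shift])

lemma summable_sub (hφ : IsRegularPotential φ D V) (h : ∀ i ∉ K, y i = z i) :
    Summable fun g => φ (shift g y) - φ (shift g z) := by
  obtain ⟨b, hb, -, -, hK⟩ := hφ.oscillation K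
  refine Summable.of_norm_bounded_eventually hb ?_
  refine K.finite_toSet.eventually_cofinite_notMem.mono fun g hg => ?_
  exact hK g hg y z h

lemma cocycle_add (hφ : IsRegularPotential φ D V) (h : ∀ i ∉ K, y i = z i)
    (h' : ∀ i ∉ K, z i = u i) : cocycle φ y z + cocycle φ z u = cocycle φ y u := by
  rw [cocycle, cocycle, ← (hφ.summable_sub h).tsum_add (hφ.summable_sub h')]
  simp [cocycle]

lemma tendsto_energy_sub (hφ : IsRegularPotential φ D V) {E : ℕ → Finset G}
    (hE : IsExhaustion E) (h : ∀ i ∉ K, y i = z i) :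
    Tendsto (fun m => energy φ (E m) y - energy φ (E m) z) atTop (𝓝 (cocycle φ y z)) := by
  simp only [energy_sub_energy]
  exact (hφ.summable_sub h).hasSum.comp hE.tendsto_atTop

/-- Sites off `K` contribute at most the total oscillation `|K| V`. On `K`, replacing both terms by
constant configurations costs `2 D` per site. The bound is uniform in `F ⊇ K` and its exponential
factorizes over sites, so it can dominate sums over patterns. -/
lemma energy_sub_le (hφ : IsRegularPotential φ D V) (h : ∀ i ∉ K, y i = z i) {F : Finset G}
    (hF : K ⊆ F) : energy φ F y - energy φ F z ≤
      ∑ g ∈ K, (φ (fun _ => y g) - φ fun _ => z g) + K.card * (2 * D + V) := by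
  classical
  obtain ⟨b, hb, hb0, hbV, hK⟩ := hφ.oscillation K
  rw [energy_sub_energy, ← Finset.sum_sdiff hF]
  have h1 : ∑ g ∈ F \ K, (φ (shift g y) - φ (shift g z)) ≤ K.card * V := by
    refine le_trans (Finset.sum_le_sum fun g hg => ?_)
      ((hb.sum_le_tsum (F \ K) fun g _ => hb0 g).trans hbV)
    exact (le_abs_self _).trans (hK g (Finset.mem_sdiff.1 hg).2 y z h)
  have h2 : ∑ g ∈ K, (φ (shift g y) - φ (shift g z)) ≤
      ∑ g ∈ K, ((φ (fun _ => y g) - φ fun _ => z g) + 2 * D) := by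
    refine Finset.sum_le_sum fun g _ => ?_
    have := abs_le.1 (hφ.abs_sub_const_le g y)
    have := abs_le.1 (hφ.abs_sub_const_le g z)
    linarith
  rw [Finset.sum_add_distrib, Finset.sum_const, nsmul_eq_mul] at h2
  linarith

lemma cocycle_le (hφ : IsRegularPotential φ D V) (h : ∀ i ∉ K, y i = z i) :
    cocycle φ y z ≤
      ∑ g ∈ K, (φ (fun _ => y g) - φ fun _ => z g) + K.card * (2 * D + V) := by
  refine le_of_tendsto (hφ.summable_sub h).hasSum ?_
  filter_upwards [eventually_ge_atTop K] with F hF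
  simpa [energy_sub_energy] using hφ.energy_sub_le h hF

/-- Off `K` the oscillation bound is uniform in `x`. On `K` the potential may be unbounded, so there
a bound `B` has to be supplied; it comes from finite alphabets or fixed patterns. -/
lemma exists_summable_bound (hφ : IsRegularPotential φ D V) {T S : (G → ℕ) → G → ℕ}
    (hTS : ∀ x, ∀ i ∉ K, T x i = S x i) {B : ℝ}
    (hB : ∀ g ∈ K, ∀ x, |φ (shift g (T x)) - φ (shift g (S x))| ≤ B) :
    ∃ b : G → ℝ, Summable b ∧ ∀ g x, ‖φ (shift g (T x)) - φ (shift g (S x))‖ ≤ b g := by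
  classical
  obtain ⟨b, hb, hb0, -, hK⟩ := hφ.oscillation K
  refine ⟨fun g => if g ∈ K then B else b g, ?_, fun g x => ?_⟩
  · refine (summable_congr_cofinite ?_).2 hb
    refine K.finite_toSet.eventually_cofinite_notMem.mono fun g hg => ?_
    exact if_neg hg
  · by_cases hg : g ∈ K
    · simpa [hg] using hB g hg x
    · simpa [hg] using hK g hg _ _ (hTS x)

lemma tendstoUniformly_energy_sub (hφ : IsRegularPotential φ D V) {T S : (G → ℕ) → G → ℕ}
    (hTS : ∀ x, ∀ i ∉ K, T x i = S x i) {B : ℝ}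
    (hB : ∀ g ∈ K, ∀ x, |φ (shift g (T x)) - φ (shift g (S x))| ≤ B) {E : ℕ → Finset G}
    (hE : IsExhaustion E) :
    TendstoUniformly (fun m x => energy φ (E m) (T x) - energy φ (E m) (S x))
      (fun x => cocycle φ (T x) (S x)) atTop := by
  obtain ⟨b, hb, hbound⟩ := hφ.exists_summable_bound hTS hB
  simp only [energy_sub_energy]
  intro U hU
  exact hE.tendsto_atTop.eventually (tendstoUniformly_tsum hb hbound U hU)

lemma continuous_cocycle (hφ : IsRegularPotential φ D V) {T S : (G → ℕ) → G → ℕ}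
    (hTS : ∀ x, ∀ i ∉ K, T x i = S x i) {B : ℝ}
    (hB : ∀ g ∈ K, ∀ x, |φ (shift g (T x)) - φ (shift g (S x))| ≤ B)
    (hT : Continuous T) (hS : Continuous S) : Continuous fun x => cocycle φ (T x) (S x) := by
  obtain ⟨b, hb, hbound⟩ := hφ.exists_summable_bound hTS hB
  refine continuous_tsum (fun g => ?_) hb hbound
  exact (hφ.continuous.comp ((continuous_shift g).comp hT)).sub
    (hφ.continuous.comp ((continuous_shift g).comp hS))

lemma exists_abs_cocycle_le (hφ : IsRegularPotential φ D V) {T S : (G → ℕ) → G → ℕ}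
    (hTS : ∀ x, ∀ i ∉ K, T x i = S x i) {B : ℝ}
    (hB : ∀ g ∈ K, ∀ x, |φ (shift g (T x)) - φ (shift g (S x))| ≤ B) :
    ∃ C, ∀ x, |cocycle φ (T x) (S x)| ≤ C := by
  obtain ⟨b, hb, hbound⟩ := hφ.exists_summable_bound hTS hB
  exact ⟨∑' g, b g, fun x => tsum_of_norm_bounded hb.hasSum fun g => hbound g x⟩

/-- A symbol is either fixed or moved within the finite set `A`, on which the values at constant
configurations are bounded. -/
lemma abs_sub_le_of_coordPerms (hφ : IsRegularPotential φ D V) {A : Finset ℕ}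
    {τ : (G → ℕ) ≃ (G → ℕ)} (hτ : τ ∈ coordPerms K A) :
    ∀ g ∈ K, ∀ x, |φ (shift g (τ x)) - φ (shift g x)| ≤
      2 * D + 2 * ∑ a ∈ A, |φ fun _ => a| := by
  intro g hg x
  have h1 := abs_le.1 (hφ.abs_sub_const_le g (τ x))
  have h2 := abs_le.1 (hφ.abs_sub_const_le g x)
  have h3 : |φ (fun _ => τ x g) - φ (fun _ => x g)| ≤ 2 * ∑ a ∈ A, |φ fun _ => a| := by
    obtain ⟨σ, hσ, h⟩ := hτ
    rw [(h x).1 g hg]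
    by_cases ha : x g ∈ A
    · have ha' : σ g (x g) ∈ A := by
        by_contra hc
        have := (σ g).injective (hσ g hg _ hc)
        exact hc (this.symm ▸ ha)
      have e1 := Finset.single_le_sum (f := fun a => |φ fun _ => a|)
        (fun _ _ => abs_nonneg _) ha
      have e2 := Finset.single_le_sum (f := fun a => |φ fun _ => a|)
        (fun _ _ => abs_nonneg _) ha'
      refine (abs_sub _ _).trans ?_
      linarith
    · rw [hσ g hg _ ha]
      simp only [sub_self, abs_zero]
      positivity
  have h3 := abs_le.1 h3
  rw [abs_le]
  constructor <;> linarith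

lemma abs_sub_le_of_splice (hφ : IsRegularPotential φ D V) (v w : K → ℕ) :
    ∀ g ∈ K, ∀ x, |φ (shift g (splice K v x)) - φ (shift g (splice K w x))| ≤
      2 * D + ∑ g, (|φ fun _ => v g| + |φ fun _ => w g|) := by
  intro g hg x
  have h1 := abs_le.1 (hφ.abs_sub_const_le g (splice K v x))
  have h2 := abs_le.1 (hφ.abs_sub_const_le g (splice K w x))
  rw [splice_of_mem _ _ hg] at h1 h2
  have h3 := Finset.single_le_sum (f := fun g => |φ fun _ => v g| + |φ fun _ => w g|)
    (fun _ _ => by positivity) (Finset.mem_univ (⟨g, hg⟩ : K))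
  have h4 := abs_le.1 (le_refl |φ fun _ => v ⟨g, hg⟩|)
  have h5 := abs_le.1 (le_refl |φ fun _ => w ⟨g, hg⟩|)
  rw [abs_le]
  constructor <;> linarith

end IsRegularPotential

end Cocycle

/-! ### The Gibbs kernels and the limits defining the specification. -/

section Specification

/-- Both sides are the total mass of a product of finite atomic measures on `ℕ`. -/
lemma tsum_prod_pi_eq_prod_tsum {ι : Type*} [Fintype ι] (f : ι → ℕ → ℝ≥0∞)
    (hf : ∀ i, ∑' a, f i a ≠ ∞) :
    ∑' w : ι → ℕ, ∏ i, f i (w i) = ∏ i, ∑' a, f i a := by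
  let μ : ι → Measure ℕ := fun i => Measure.sum fun a => f i a • Measure.dirac a
  have hμ : ∀ i a, μ i {a} = f i a := by
    intro i a
    rw [Measure.sum_apply _ (measurableSet_singleton a), tsum_eq_single a]
    · simp
    · intro b hb
      simp [hb]
  have hμu : ∀ i, μ i Set.univ = ∑' a, f i a := fun i => by simp [μ]
  have : ∀ i, IsFiniteMeasure (μ i) := fun i => ⟨by
    rw [hμu]; exact (hf i).lt_top⟩
  have h1 := Measure.pi_univ μ
  rw [← MeasureTheory.Measure.tsum_indicator_apply_singleton (Measure.pi μ) Set.univ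
    MeasurableSet.univ] at h1
  simpa [hμ, hμu, Measure.pi_singleton] using h1

section Sites

variable {G : Type*} {φ : (G → ℕ) → ℝ} {K : Finset G}

lemma splice_eq_off (K : Finset G) (v w : K → ℕ) (x : G → ℕ) :
    ∀ i ∉ K, splice K v x i = splice K w x i := fun i hi => by
  simp [splice_of_notMem, hi]

/-- A summable majorant for the weights of patterns on `K`. -/
noncomputable def weightBound (φ : (G → ℕ) → ℝ) (K : Finset G) (C : ℝ) (w : K → ℕ) : ℝ≥0∞ :=
  ENNReal.ofReal (Real.exp C) * ∏ g, ENNReal.ofReal (Real.exp (φ fun _ => w g))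

/-- The constant `C` absorbs the reference pattern `0`, leaving a product of one-site factors in
`w`. -/
lemma ofReal_exp_le_weightBound {C c t : ℝ} {w : K → ℕ} {z : G → ℕ}
    (h : t ≤ ∑ g ∈ K, (φ (fun _ => splice K w z g) - φ fun _ => splice K 0 z g) + c)
    (hC : c - ∑ g ∈ K, φ (fun _ => splice K 0 z g) ≤ C) :
    ENNReal.ofReal (Real.exp t) ≤ weightBound φ K C w := by
  rw [weightBound, ← ENNReal.ofReal_prod_of_nonneg (fun _ _ => (Real.exp_pos _).le),
    ← ENNReal.ofReal_mul (Real.exp_pos _).le, ← Real.exp_sum, ← Real.exp_add]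
  refine ENNReal.ofReal_le_ofReal (Real.exp_le_exp.2 ?_)
  have : ∑ g ∈ K, φ (fun _ => splice K w z g) = ∑ g : K, φ (fun _ => w g) := by
    rw [← Finset.sum_coe_sort K]
    exact Finset.sum_congr rfl fun g _ => by rw [splice_of_mem w z g.2]
  rw [Finset.sum_sub_distrib, this] at h
  linarith

end Sites

section Weights

variable {G : Type*} [Group G]

/-- The unnormalized weight of the pattern `w` on `K` given the boundary condition `x`. -/
noncomputable def gibbsWeight (φ : (G → ℕ) → ℝ) (K : Finset G) (x : G → ℕ) (w : K → ℕ) : ℝ≥0∞ :=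
  ENNReal.ofReal (Real.exp (cocycle φ (splice K w x) (splice K 0 x)))

/-- The conditional probability of the pattern `w` on `K` given the boundary condition `x`. -/
noncomputable def gibbsProb (φ : (G → ℕ) → ℝ) (K : Finset G) (x : G → ℕ) (w : K → ℕ) : ℝ≥0∞ :=
  gibbsWeight φ K x w / ∑' v, gibbsWeight φ K x v

/-- The Gibbs measure on `K` with boundary condition `x`. -/
noncomputable def gibbsKernel (φ : (G → ℕ) → ℝ) (K : Finset G) (x : G → ℕ) : Measure (G → ℕ) :=
  Measure.sum fun w => gibbsProb φ K x w • Measure.dirac (splice K w x)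

variable {φ : (G → ℕ) → ℝ} {D V : ℝ} {K : Finset G}

lemma gibbsProb_splice (φ : (G → ℕ) → ℝ) (K : Finset G) (x : G → ℕ) (v w : K → ℕ) :
    gibbsProb φ K (splice K v x) w = gibbsProb φ K x w := by
  simp [gibbsProb, gibbsWeight, splice_splice]

lemma tsum_gibbsWeight_ne_zero (φ : (G → ℕ) → ℝ) (K : Finset G) (x : G → ℕ) :
    ∑' w, gibbsWeight φ K x w ≠ 0 := by
  rw [Ne, ENNReal.tsum_eq_zero]
  intro h
  have := h 0
  simp [gibbsWeight] at this

namespace IsRegularPotential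

lemma continuous_cocycle_coordPerms (hφ : IsRegularPotential φ D V) {K : Finset G}
    {A : Finset ℕ} {τ : (G → ℕ) ≃ (G → ℕ)} (hτ : τ ∈ coordPerms K A) :
    Continuous fun x => cocycle φ (τ.symm x) x :=
  hφ.continuous_cocycle (S := id)
    (fun x _ hi => apply_eq_of_mem_coordPerms (symm_mem_coordPerms hτ) x hi)
    (hφ.abs_sub_le_of_coordPerms (symm_mem_coordPerms hτ))
    (continuous_of_mem_coordPerms (symm_mem_coordPerms hτ)) continuous_id

lemma tsum_weightBound_ne_top (hφ : IsRegularPotential φ D V) (K : Finset G) (C : ℝ) :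
    ∑' w, weightBound φ K C w ≠ ∞ := by
  simp only [weightBound]
  rw [ENNReal.tsum_mul_left, tsum_prod_pi_eq_prod_tsum
    (fun (_ : K) a => ENNReal.ofReal (Real.exp (φ fun _ => a))) fun _ => hφ.tsum_exp.ne]
  exact ENNReal.mul_ne_top ENNReal.ofReal_ne_top
    (ENNReal.prod_ne_top fun _ _ => hφ.tsum_exp.ne)

lemma tsum_gibbsWeight_ne_top (hφ : IsRegularPotential φ D V) (K : Finset G) (x : G → ℕ) :
    ∑' w, gibbsWeight φ K x w ≠ ∞ := by
  refine ne_top_of_le_ne_top (hφ.tsum_weightBound_ne_top K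
    (K.card * (2 * D + V) - ∑ g ∈ K, φ (fun _ => splice K 0 x g)))
    (ENNReal.tsum_le_tsum fun w => ?_)
  exact ofReal_exp_le_weightBound (hφ.cocycle_le (splice_eq_off K w 0 x)) le_rfl

lemma tsum_gibbsProb (hφ : IsRegularPotential φ D V) (K : Finset G) (x : G → ℕ) :
    ∑' w, gibbsProb φ K x w = 1 := by
  simp only [gibbsProb, div_eq_mul_inv]
  rw [ENNReal.tsum_mul_right, ENNReal.mul_inv_cancel (tsum_gibbsWeight_ne_zero φ K x)
    (hφ.tsum_gibbsWeight_ne_top K x)]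

/-- The cocycle identity removes the reference pattern `0`, and the normalizations cancel. -/
lemma gibbsProb_eq_mul (hφ : IsRegularPotential φ D V) (K : Finset G) (x : G → ℕ)
    (v w : K → ℕ) : gibbsProb φ K x v = gibbsProb φ K x w *
      ENNReal.ofReal (Real.exp (cocycle φ (splice K v x) (splice K w x))) := by
  rw [gibbsProb, gibbsProb, ENNReal.div_eq_inv_mul, ENNReal.div_eq_inv_mul, mul_assoc]
  congr 1
  rw [gibbsWeight, gibbsWeight, ← ENNReal.ofReal_mul (Real.exp_pos _).le, ← Real.exp_add,
    add_comm, hφ.cocycle_add (splice_eq_off K v w x) (splice_eq_off K w 0 x)]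

lemma isProbabilityMeasure_gibbsKernel (hφ : IsRegularPotential φ D V) (K : Finset G)
    (x : G → ℕ) : IsProbabilityMeasure (gibbsKernel φ K x) :=
  ⟨by simp [gibbsKernel, hφ.tsum_gibbsProb]⟩

end IsRegularPotential

lemma lintegral_gibbsKernel (φ : (G → ℕ) → ℝ) (K : Finset G) (x : G → ℕ) {f : (G → ℕ) → ℝ≥0∞}
    (hf : Measurable f) :
    ∫⁻ y, f y ∂gibbsKernel φ K x = ∑' w, gibbsProb φ K x w * f (splice K w x) := by
  simp [gibbsKernel, lintegral_sum_measure, lintegral_smul_measure, lintegral_dirac' _ hf]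

lemma gibbsKernel_apply (φ : (G → ℕ) → ℝ) (K : Finset G) (x : G → ℕ) {B : Set (G → ℕ)}
    (hB : MeasurableSet B) :
    gibbsKernel φ K x B = ∑' w, gibbsProb φ K x w * B.indicator 1 (splice K w x) := by
  rw [← lintegral_indicator_one hB, lintegral_gibbsKernel φ K x (measurable_one.indicator hB)]

lemma gibbsKernel_splice (φ : (G → ℕ) → ℝ) (K : Finset G) (x : G → ℕ) (v : K → ℕ) :
    gibbsKernel φ K (splice K v x) = gibbsKernel φ K x := by
  simp [gibbsKernel, gibbsProb_splice, splice_splice]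

/-- After dividing numerator and denominator by the weight of the pattern `0`, each term converges
to its cocycle weight. `weightBound` dominates as soon as `E_m` contains `K`. -/
theorem IsRegularPotential.isGibbsSpecification (hφ : IsRegularPotential φ D V) {E : ℕ → Finset G}
    (hE : IsExhaustion E) :
    IsGibbsSpecification E φ fun K B x => gibbsKernel φ K x B := by
  intro K _ B hB x
  have hlim : ∀ f : (G → ℕ) → ℝ≥0∞, (∀ y, f y ≤ 1) →
      Tendsto (fun m => ∑' w : K → ℕ, f (splice K w x) * ENNReal.ofReal
        (Real.exp (energy φ (E m) (splice K w x) - energy φ (E m) (splice K 0 x)))) atTop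
        (𝓝 (∑' w, f (splice K w x) * gibbsWeight φ K x w)) := by
    intro f hf
    -- Sums over patterns become integrals against counting measure, with every function measurable.
    let _ : MeasurableSpace (K → ℕ) := ⊤
    simp only [← lintegral_count]
    refine tendsto_lintegral_filter_of_dominated_convergence
      (weightBound φ K (K.card * (2 * D + V) - ∑ g ∈ K, φ (fun _ => splice K 0 x g)))
      (Eventually.of_forall fun m => measurable_from_top) ?_ ?_ ?_
    · filter_upwards [hE.tendsto_atTop.eventually_ge_atTop K] with m hm
      refine ae_of_all _ fun w => ?_
      refine (mul_le_of_le_one_left zero_le (hf _)).trans ?_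
      exact ofReal_exp_le_weightBound (hφ.energy_sub_le (splice_eq_off K w 0 x) hm) le_rfl
    · rw [lintegral_count]
      exact hφ.tsum_weightBound_ne_top K _
    · refine ae_of_all _ fun w => ?_
      refine ENNReal.Tendsto.const_mul ?_ (Or.inr (ne_top_of_le_ne_top ENNReal.one_ne_top (hf _)))
      exact (ENNReal.continuous_ofReal.comp Real.continuous_exp).continuousAt.tendsto.comp
        (hφ.tendsto_energy_sub hE (splice_eq_off K w 0 x))
  have hB' := hlim (B.indicator 1) fun y => Set.indicator_le_self' (fun _ _ => zero_le) y
  have h1 := hlim 1 fun _ => le_rfl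
  simp only [Pi.one_apply, one_mul] at h1
  have hdiv := ENNReal.Tendsto.div hB' (Or.inr (tsum_gibbsWeight_ne_zero φ K x)) h1
    (Or.inl (hφ.tsum_gibbsWeight_ne_top K x))
  refine Tendsto.congr (fun m => ?_) (hdiv.trans_eq ?_)
  · have hexp : ∀ w : K → ℕ, ENNReal.ofReal (Real.exp (energy φ (E m) (splice K w x))) =
        ENNReal.ofReal
          (Real.exp (energy φ (E m) (splice K w x) - energy φ (E m) (splice K 0 x))) *
        ENNReal.ofReal (Real.exp (energy φ (E m) (splice K 0 x))) := fun w => by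
      rw [← ENNReal.ofReal_mul (Real.exp_pos _).le, ← Real.exp_add, sub_add_cancel]
    have hind : ∀ y : G → ℕ,
        B.indicator (fun y => ENNReal.ofReal (Real.exp (energy φ (E m) y))) y =
        B.indicator 1 y * ENNReal.ofReal (Real.exp (energy φ (E m) y)) := fun y => by
      by_cases hy : y ∈ B <;> simp [hy]
    rw [gibbsRatio, tsum_congr hexp, tsum_congr fun w => (hind (splice K w x)).trans
      ((congrArg _ (hexp w)).trans (mul_assoc _ _ _).symm), ENNReal.tsum_mul_right,
      ENNReal.tsum_mul_right, ENNReal.mul_div_mul_right _ _ _ ENNReal.ofReal_ne_top]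
    simp [Real.exp_pos]
  · simp only [gibbsKernel_apply φ K x hB]
    simp only [gibbsProb, div_eq_mul_inv]
    rw [← ENNReal.tsum_mul_right]
    congr 1
    exact tsum_congr fun w => by ring

end Weights

variable {G : Type*} [Group G] [Countable G] {φ : (G → ℕ) → ℝ} {D V : ℝ}

namespace IsRegularPotential

lemma measurable_density (hφ : IsRegularPotential φ D V) {K : Finset G}
    {A : Finset ℕ} {τ : (G → ℕ) ≃ (G → ℕ)} (hτ : τ ∈ coordPerms K A) :
    Measurable fun x => ENNReal.ofReal (Real.exp (cocycle φ (τ.symm x) x)) :=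
  (ENNReal.continuous_ofReal.comp
    (Real.continuous_exp.comp (hφ.continuous_cocycle_coordPerms hτ))).measurable

lemma measurable_gibbsProb (hφ : IsRegularPotential φ D V) (K : Finset G) (w : K → ℕ) :
    Measurable fun x => gibbsProb φ K x w := by
  have h : ∀ v : K → ℕ, Measurable fun x => gibbsWeight φ K x v := fun v =>
    (ENNReal.continuous_ofReal.comp (Real.continuous_exp.comp
      (hφ.continuous_cocycle (fun x => splice_eq_off K v 0 x) (hφ.abs_sub_le_of_splice v 0)
        (continuous_splice K v) (continuous_splice K 0)))).measurable
  exact (h w).div (Measurable.tsum h)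

lemma measurable_lintegral_gibbsKernel (hφ : IsRegularPotential φ D V) (K : Finset G)
    {f : (G → ℕ) → ℝ≥0∞} (hf : Measurable f) :
    Measurable fun x => ∫⁻ y, f y ∂gibbsKernel φ K x := by
  simp only [lintegral_gibbsKernel φ K _ hf]
  exact Measurable.tsum fun w =>
    (hφ.measurable_gibbsProb K w).mul (hf.comp (continuous_splice K w).measurable)

/-- The map `τ` permutes the patterns on `K`. Reindexing by this permutation leaves a ratio of two
pattern probabilities, which is the exponential of the cocycle. -/
lemma lintegral_gibbsKernel_comp (hφ : IsRegularPotential φ D V) {K : Finset G}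
    {A : Finset ℕ} {τ : (G → ℕ) ≃ (G → ℕ)} (hτ : τ ∈ coordPerms K A) (x : G → ℕ)
    {f : (G → ℕ) → ℝ≥0∞} (hf : Measurable f) :
    ∫⁻ y, f (τ y) ∂gibbsKernel φ K x =
      ∫⁻ y, f y * ENNReal.ofReal (Real.exp (cocycle φ (τ.symm y) y)) ∂gibbsKernel φ K x := by
  rw [lintegral_gibbsKernel φ K x (f := fun y => f (τ y))
      (hf.comp (continuous_of_mem_coordPerms hτ).measurable),
    lintegral_gibbsKernel φ K x
      (f := fun y => f y * ENNReal.ofReal (Real.exp (cocycle φ (τ.symm y) y)))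
      (hf.mul (hφ.measurable_density hτ))]
  obtain ⟨σ, hσ, h⟩ := id hτ
  have hsplice : ∀ w : K → ℕ, τ (splice K w x) = splice K (fun g => σ g (w g)) x := by
    intro w
    ext g
    by_cases hg : g ∈ K
    · simp [(h _).1 g hg, splice_of_mem, hg]
    · simp [(h _).2 g hg, splice_of_notMem, hg]
  refine Eq.trans (tsum_congr fun w => ?_) ((Equiv.piCongrRight fun g : K => σ g).tsum_eq
    fun w => gibbsProb φ K x w * (f (splice K w x) *
      ENNReal.ofReal (Real.exp (cocycle φ (τ.symm (splice K w x)) (splice K w x)))))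
  have hw : Equiv.piCongrRight (fun g : K => σ g) w = fun g : K => σ g (w g) := rfl
  rw [hw, ← hsplice w, Equiv.symm_apply_apply, hsplice w,
    hφ.gibbsProb_eq_mul K x w (fun g => σ g (w g))]
  ring

end IsRegularPotential

end Specification

/-! ### DLR and conformal measures as invariant measures of the kernels. -/

section Equivalence

section Sites

variable {G : Type*}

lemma swapSites_comm (K : Finset G) (v w : K → ℕ) : swapSites K v w = swapSites K w v := by
  ext x g
  by_cases hg : g ∈ K <;> simp [swapSites, hg, Equiv.swap_comm]

lemma measurableSet_cyl (K : Finset G) (w : K → ℕ) : MeasurableSet (cyl K w) := by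
  have : cyl K w = ⋂ g : K, (fun x : G → ℕ => x g) ⁻¹' {w g} := by
    ext x; simp [cyl]
  rw [this]
  exact MeasurableSet.iInter fun g => measurable_pi_apply _ (measurableSet_singleton _)

lemma tsum_indicator_cyl (K : Finset G) (x : G → ℕ) (a : (K → ℕ) → ℝ≥0∞) :
    ∑' w, (cyl K w).indicator 1 x * a w = a fun g => x g := by
  rw [tsum_eq_single (fun g : K => x g)]
  · have : x ∈ cyl K (fun g => x g) := fun _ => rfl
    simp [this]
  · intro w hw
    have : x ∉ cyl K w := fun h => hw (funext fun g => (h g).symm)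
    simp [this]

lemma measurable_splice_cylinderEvents (K : Finset G) (w : K → ℕ) :
    Measurable[cylinderEvents (X := fun _ : G => ℕ) ((K : Set G)ᶜ)] (splice K w) := by
  refine @measurable_pi_lambda _ _ _ (cylinderEvents (X := fun _ : G => ℕ) ((K : Set G)ᶜ)) _ _
    fun g => ?_
  by_cases hg : g ∈ K
  · simp only [splice_of_mem _ _ hg]
    exact @measurable_const _ _ _ (cylinderEvents (X := fun _ : G => ℕ) ((K : Set G)ᶜ)) _
  · simp only [splice_of_notMem _ _ hg]
    exact measurable_cylinderEvent_apply (by simpa using hg)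

end Sites

section Definitions

variable {G : Type*} [Group G]

/-- Invariance of `μ` under the Gibbs kernel on `K`. -/
def IsGibbsInvariantOn (φ : (G → ℕ) → ℝ) (K : Finset G) (μ : Measure (G → ℕ)) : Prop :=
  ∀ f : (G → ℕ) → ℝ≥0∞, Measurable f →
    ∫⁻ x, f x ∂μ = ∫⁻ x, ∫⁻ y, f y ∂gibbsKernel φ K x ∂μ

/-- Conformality of `μ` with respect to the coordinate-wise permutations on `K`. -/
def IsConformalOn (φ : (G → ℕ) → ℝ) (K : Finset G) (μ : Measure (G → ℕ)) : Prop :=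
  ∀ A : Finset ℕ, A.Nonempty → ∀ τ ∈ coordPerms K A, ∀ f : (G → ℕ) → ℝ≥0∞, Measurable f →
    ∫⁻ x, f (τ x) ∂μ = ∫⁻ x, f x * ENNReal.ofReal (Real.exp (cocycle φ (τ.symm x) x)) ∂μ

/-- Resampling on `K` does not affect membership in `C`, so the indicator of `C` passes through the
kernel. -/
lemma IsGibbsInvariantOn.setLIntegral_gibbsKernel {φ : (G → ℕ) → ℝ} {K : Finset G} {μ : Measure (G → ℕ)}
    (h : IsGibbsInvariantOn φ K μ)
    {B C : Set (G → ℕ)} (hB : MeasurableSet B)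
    (hC : MeasurableSet[cylinderEvents (X := fun _ : G => ℕ) ((K : Set G)ᶜ)] C) :
    ∫⁻ x in C, gibbsKernel φ K x B ∂μ = μ (B ∩ C) := by
  have hC' : MeasurableSet C := cylinderEvents_le_pi _ hC
  have hinv : ∀ (w : K → ℕ) x, splice K w x ∈ C ↔ x ∈ C := by
    intro w x
    -- Events off `K` are preimages under `splice K 0`, which forgets the pattern on `K`.
    have hsub : cylinderEvents (X := fun _ : G => ℕ) ((K : Set G)ᶜ) ≤
        MeasurableSpace.comap (splice K 0) MeasurableSpace.pi := by
      refine iSup₂_le fun g hg => ?_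
      rintro _ ⟨S, hS, rfl⟩
      refine ⟨(fun x : G → ℕ => x g) ⁻¹' S, measurable_pi_apply g hS, ?_⟩
      ext x
      simp [splice_of_notMem _ _ (show g ∉ K by simpa using hg)]
    obtain ⟨S, -, rfl⟩ := hsub _ hC
    simp [splice_splice]
  rw [← lintegral_indicator_one (hB.inter hC'), h _ (measurable_one.indicator (hB.inter hC')),
    ← lintegral_indicator hC']
  refine lintegral_congr fun x => ?_
  rw [lintegral_gibbsKernel φ K x (measurable_one.indicator (hB.inter hC'))]
  by_cases hx : x ∈ C
  · rw [Set.indicator_of_mem hx, gibbsKernel_apply φ K x hB]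
    refine tsum_congr fun w => ?_
    rw [Set.inter_comm, ← Set.indicator_indicator, Set.indicator_of_mem ((hinv w x).2 hx)]
  · rw [Set.indicator_of_notMem hx]
    symm
    rw [ENNReal.tsum_eq_zero]
    intro w
    rw [Set.inter_comm, ← Set.indicator_indicator,
      Set.indicator_of_notMem (fun hc => hx ((hinv w x).1 hc)), mul_zero]

end Definitions

variable {G : Type*} [Group G] [Countable G] {φ : (G → ℕ) → ℝ} {D V : ℝ} {K : Finset G}
  {μ : Measure (G → ℕ)}

namespace IsRegularPotential

lemma isConformalOn_of_isGibbsInvariantOn (hφ : IsRegularPotential φ D V)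
    (h : IsGibbsInvariantOn φ K μ) : IsConformalOn φ K μ := by
  intro A _ τ hτ f hf
  rw [h (fun x => f (τ x)) (hf.comp (continuous_of_mem_coordPerms hτ).measurable),
    h (fun x => f x * ENNReal.ofReal (Real.exp (cocycle φ (τ.symm x) x)))
      (hf.mul (hφ.measurable_density hτ))]
  exact lintegral_congr fun x => hφ.lintegral_gibbsKernel_comp hτ x hf

/-- This is detailed balance between `v` and `w`: `swapSites` exchanges their cylinders, and its
density turns the probability of `w` into that of `v`. -/
lemma lintegral_swap (hφ : IsRegularPotential φ D V) (h : IsConformalOn φ K μ) (v w : K → ℕ)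
    {f : (G → ℕ) → ℝ≥0∞} (hf : Measurable f) :
    ∫⁻ x, (cyl K w).indicator 1 x * (gibbsProb φ K x v * f (splice K v x)) ∂μ =
      ∫⁻ x, (cyl K v).indicator 1 x * (gibbsProb φ K x w * f x) ∂μ := by
  have hF : Measurable fun x => (cyl K w).indicator (1 : (G → ℕ) → ℝ≥0∞) x *
      (gibbsProb φ K x w * f (splice K v x)) :=
    (measurable_one.indicator (measurableSet_cyl K w)).mul
      ((hφ.measurable_gibbsProb K w).mul (hf.comp (continuous_splice K v).measurable))
  have := h _ (Finset.insert_nonempty _ _) _ (swapSites_mem_coordPerms K v w) _ hF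
  calc _ = _ := lintegral_congr fun x => ?_
    _ = _ := this.symm
    _ = _ := lintegral_congr fun x => ?_
  · by_cases hx : x ∈ cyl K w
    · rw [swapSites_symm, swapSites_apply_of_mem_cyl hx]
      have hc : cocycle φ (splice K v x) x = cocycle φ (splice K v x) (splice K w x) := by
        rw [splice_eq_self hx]
      rw [hφ.gibbsProb_eq_mul K x v w, hc]
      ring
    · simp [hx]
  · by_cases hx : x ∈ cyl K v
    · have hx' : swapSites K v w x ∈ cyl K w := swapSites_mem_cyl_iff.2 hx
      rw [Set.indicator_of_mem hx', Set.indicator_of_mem hx, swapSites_comm,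
        swapSites_apply_of_mem_cyl hx, gibbsProb_splice, splice_splice, splice_eq_self hx]
      rfl
    · have hx' : swapSites K v w x ∉ cyl K w := fun h => hx (swapSites_mem_cyl_iff.1 h)
      simp [hx, hx']

/-- Split according to the present pattern `w` and the resampled pattern `v`. Detailed balance
exchanges their roles; the probabilities of `w` then sum to 1 and the cylinders of `v` partition the
space. -/
lemma isGibbsInvariantOn_of_isConformalOn (hφ : IsRegularPotential φ D V)
    (h : IsConformalOn φ K μ) : IsGibbsInvariantOn φ K μ := by
  intro f hf
  have hind : ∀ w, Measurable fun x => (cyl K w).indicator (1 : (G → ℕ) → ℝ≥0∞) x := fun w =>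
    measurable_one.indicator (measurableSet_cyl K w)
  have hmeas : ∀ v w, Measurable fun x => (cyl K w).indicator (1 : (G → ℕ) → ℝ≥0∞) x *
      (gibbsProb φ K x v * f (splice K v x)) := fun v w => (hind w).mul
      ((hφ.measurable_gibbsProb K v).mul (hf.comp (continuous_splice K v).measurable))
  have hmeas' : ∀ v w, Measurable fun x => (cyl K v).indicator (1 : (G → ℕ) → ℝ≥0∞) x *
      (gibbsProb φ K x w * f x) := fun v w => (hind v).mul
      ((hφ.measurable_gibbsProb K w).mul hf)
  symm
  calc ∫⁻ x, ∫⁻ y, f y ∂gibbsKernel φ K x ∂μ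
      = ∫⁻ x, ∑' v, ∑' w, (cyl K w).indicator 1 x *
          (gibbsProb φ K x v * f (splice K v x)) ∂μ := by
        refine lintegral_congr fun x => ?_
        rw [lintegral_gibbsKernel φ K x hf]
        exact tsum_congr fun v => (tsum_indicator_cyl K x fun _ => _).symm
    _ = ∑' v, ∑' w, ∫⁻ x, (cyl K w).indicator 1 x *
          (gibbsProb φ K x v * f (splice K v x)) ∂μ := by
        rw [lintegral_tsum fun v => (Measurable.tsum fun w => hmeas v w).aemeasurable]
        exact tsum_congr fun v => lintegral_tsum fun w => (hmeas v w).aemeasurable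
    _ = ∑' v, ∑' w, ∫⁻ x, (cyl K v).indicator 1 x * (gibbsProb φ K x w * f x) ∂μ := by
        simp only [hφ.lintegral_swap h _ _ hf]
    _ = ∫⁻ x, ∑' v, ∑' w, (cyl K v).indicator 1 x * (gibbsProb φ K x w * f x) ∂μ := by
        rw [lintegral_tsum fun v => (Measurable.tsum fun w => hmeas' v w).aemeasurable]
        exact tsum_congr fun v => (lintegral_tsum fun w => (hmeas' v w).aemeasurable).symm
    _ = ∫⁻ x, f x ∂μ := by
        refine lintegral_congr fun x => ?_
        refine Eq.trans (tsum_congr fun v => ?_) (tsum_indicator_cyl K x fun _ => f x)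
        rw [ENNReal.tsum_mul_left, ENNReal.tsum_mul_right, hφ.tsum_gibbsProb, one_mul]

theorem isConformal_iff (hφ : IsRegularPotential φ D V) {E : ℕ → Finset G}
    (hE : IsExhaustion E) :
    IsConformal E φ μ ↔ ∀ K : Finset G, K.Nonempty → IsConformalOn φ K μ := by
  constructor
  · intro h K hK A hA τ hτ f hf
    obtain ⟨ψ, hψ, hμ⟩ := h A hA K hK τ hτ
    have hψ' : ψ = fun x => cocycle φ (τ.symm x) x := funext fun x =>
      tendsto_nhds_unique (hψ.tendsto_at x) (hφ.tendsto_energy_sub hE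
        fun _ hi => apply_eq_of_mem_coordPerms (symm_mem_coordPerms hτ) x hi)
    subst hψ'
    rw [← lintegral_map hf (continuous_of_mem_coordPerms hτ).measurable, hμ,
      lintegral_withDensity_eq_lintegral_mul _ (hφ.measurable_density hτ) hf]
    exact lintegral_congr fun x => mul_comm _ _
  · intro h A hA K hK τ hτ
    refine ⟨fun x => cocycle φ (τ.symm x) x, ?_, ?_⟩
    · exact hφ.tendstoUniformly_energy_sub (S := id)
        (fun x _ hi => apply_eq_of_mem_coordPerms (symm_mem_coordPerms hτ) x hi)
        (hφ.abs_sub_le_of_coordPerms (symm_mem_coordPerms hτ)) hE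
    · ext B hB
      have hτm := (continuous_of_mem_coordPerms hτ).measurable
      have := h K hK A hA τ hτ (B.indicator 1) (measurable_one.indicator hB)
      rw [← lintegral_map (measurable_one.indicator hB) hτm, lintegral_indicator_one hB] at this
      rw [this, withDensity_apply _ hB, ← lintegral_indicator hB]
      refine lintegral_congr fun x => ?_
      by_cases hx : x ∈ B <;> simp [hx]

/-- The kernel ignores the coordinates in `K`, so it factors through `splice K 0`, which is
measurable for the coordinates off `K`. -/
lemma measurable_lintegral_gibbsKernel_cylinderEvents (hφ : IsRegularPotential φ D V)
    (K : Finset G) {f : (G → ℕ) → ℝ≥0∞} (hf : Measurable f) :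
    Measurable[cylinderEvents (X := fun _ : G => ℕ) ((K : Set G)ᶜ)]
      fun x => ∫⁻ y, f y ∂gibbsKernel φ K x := by
  have := (hφ.measurable_lintegral_gibbsKernel K hf).comp (measurable_splice_cylinderEvents K 0)
  simpa [Function.comp_def, gibbsKernel_splice] using this

theorem isDLR_iff (hφ : IsRegularPotential φ D V) {E : ℕ → Finset G} (hE : IsExhaustion E)
    [IsProbabilityMeasure μ] :
    IsDLR E φ μ ↔ ∀ K : Finset G, K.Nonempty → IsGibbsInvariantOn φ K μ := by
  have hprob := hφ.isProbabilityMeasure_gibbsKernel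
  have hmeas : ∀ (K : Finset G) {B : Set (G → ℕ)}, MeasurableSet B →
      Measurable[cylinderEvents (X := fun _ : G => ℕ) ((K : Set G)ᶜ)]
        fun x => gibbsKernel φ K x B := fun K B hB => by
    simpa [lintegral_indicator_one hB] using
      hφ.measurable_lintegral_gibbsKernel_cylinderEvents K (measurable_one.indicator hB)
  have hmeas' : ∀ (K : Finset G) {B : Set (G → ℕ)}, MeasurableSet B →
      Measurable fun x => gibbsKernel φ K x B := fun K B hB =>
    (hmeas K hB).mono cylinderEvents_le_pi le_rfl
  have hint : ∀ (K : Finset G) {B : Set (G → ℕ)}, MeasurableSet B →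
      Integrable (fun x => (gibbsKernel φ K x B).toReal) μ := fun K B hB =>
    Integrable.of_bound (hmeas' K hB).ennreal_toReal.aestronglyMeasurable
      1 (ae_of_all _ fun x => by
        rw [Real.norm_of_nonneg ENNReal.toReal_nonneg]
        exact ENNReal.toReal_le_of_le_ofReal zero_le_one (by simpa using prob_le_one))
  constructor
  · rintro ⟨γ, hγ, h⟩ K hK
    have key : ∀ B, MeasurableSet B → μ B = ∫⁻ x, gibbsKernel φ K x B ∂μ := by
      intro B hB
      have hγ' : ∀ x, γ K B x = gibbsKernel φ K x B := fun x =>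
        tendsto_nhds_unique (hγ K hK B hB x) (hφ.isGibbsSpecification hE K hK B hB x)
      -- For this direction the tower property over the whole space suffices.
      have h1 := integral_congr_ae (h K hK B hB)
      rw [integral_condExp cylinderEvents_le_pi, integral_indicator_const _ hB, smul_eq_mul,
        mul_one] at h1
      simp only [hγ'] at h1
      rw [integral_toReal (hmeas' K hB).aemeasurable (ae_of_all _ fun x => measure_lt_top _ _),
        measureReal_def, ENNReal.toReal_eq_toReal_iff' (measure_ne_top _ _)] at h1
      · exact h1
      · refine ne_top_of_le_ne_top ENNReal.one_ne_top
          ((lintegral_mono (g := fun _ => 1) fun x => prob_le_one).trans ?_)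
        simp
    have hκ : Measurable (gibbsKernel φ K) :=
      Measure.measurable_of_measurable_coe _ fun B hB => hmeas' K hB
    have hbind : μ = μ.bind (gibbsKernel φ K) := by
      ext B hB
      rw [Measure.bind_apply hB hκ.aemeasurable, key B hB]
    intro f hf
    conv_lhs => rw [hbind]
    exact Measure.lintegral_bind hκ.aemeasurable hf.aemeasurable
  · intro h
    refine ⟨_, hφ.isGibbsSpecification hE, fun K hK B hB => ?_⟩
    symm
    refine ae_eq_condExp_of_forall_setIntegral_eq cylinderEvents_le_pi ?_ ?_ ?_ ?_
    · exact (integrable_const 1).indicator hB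
    · exact fun s _ _ => (hint K hB).integrableOn
    · intro s hs _
      rw [integral_toReal (hmeas' K hB).aemeasurable
        (ae_of_all _ fun x => measure_lt_top _ _), (h K hK).setLIntegral_gibbsKernel hB hs]
      rw [integral_indicator_const _ hB, smul_eq_mul, mul_one, measureReal_restrict_apply hB,
        measureReal_def]
    · exact (hmeas K hB).ennreal_toReal.stronglyMeasurable.aestronglyMeasurable

end IsRegularPotential

end Equivalence

/-! ### Tightness from one-site bounds, and averages of translates. -/

section TightnessAndAveraging

section Tightness

variable {G : Type*} [Countable G]

/-- The compact set is a product of finite sets `{0, …, N_g - 1}`, with tails at most `ε_g` and `∑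
ε_g < ε`. -/
lemma isTightMeasureSet_of_forall_site {t : ℕ → ℝ≥0∞} (ht : ∑' a, t a ≠ ∞)
    {S : Set (Measure (G → ℕ))} (hS : ∀ μ ∈ S, ∀ g a, μ {x | x g = a} ≤ t a) :
    IsTightMeasureSet S := by
  rw [isTightMeasureSet_iff_exists_isCompact_measure_compl_le]
  intro ε hε
  obtain ⟨ε', hε', hsum⟩ := ENNReal.exists_pos_sum_of_countable' hε.ne' G
  have hN : ∀ g, ∃ N, ∑' k, t (k + N) ≤ ε' g := fun g =>
    ((ENNReal.tendsto_sum_nat_add t ht).eventually_le_const (hε' g)).exists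
  choose N hN using hN
  refine ⟨Set.univ.pi fun g => Set.Iio (N g),
    isCompact_univ_pi fun g => (Set.finite_Iio _).isCompact, fun μ hμ => ?_⟩
  have hsub : (Set.univ.pi fun g => Set.Iio (N g))ᶜ ⊆ ⋃ g, ⋃ k, {x : G → ℕ | x g = k + N g} := by
    intro x hx
    simp only [Set.mem_compl_iff, Set.mem_univ_pi, Set.mem_Iio, not_forall, not_lt] at hx
    obtain ⟨g, hg⟩ := hx
    simp only [Set.mem_iUnion, Set.mem_ofPred_eq]
    exact ⟨g, x g - N g, by omega⟩
  calc μ (Set.univ.pi fun g => Set.Iio (N g))ᶜ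
      ≤ ∑' g, ∑' k, μ {x | x g = k + N g} :=
        (measure_mono hsub).trans ((measure_iUnion_le _).trans
          (ENNReal.tsum_le_tsum fun g => measure_iUnion_le _))
    _ ≤ ∑' g, ∑' k, t (k + N g) :=
        ENNReal.tsum_le_tsum fun g => ENNReal.tsum_le_tsum fun k => hS μ hμ g _
    _ ≤ ∑' g, ε' g := ENNReal.tsum_le_tsum hN
    _ ≤ ε := hsum.le

end Tightness

section Average

variable {G : Type*} [Group G]

/-- The average of the translates of `ν` by the elements of `F`. -/
noncomputable def shiftAverage (F : Finset G) (ν : Measure (G → ℕ)) : Measure (G → ℕ) :=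
  (F.card : ℝ≥0∞)⁻¹ • ∑ f ∈ F, ν.map (shift f)

lemma measurable_shift (g : G) : Measurable (shift g : (G → ℕ) → G → ℕ) :=
  measurable_pi_lambda _ fun h => measurable_pi_apply (h * g)

lemma lintegral_shiftAverage (F : Finset G) (ν : Measure (G → ℕ)) (h : (G → ℕ) → ℝ≥0∞) :
    ∫⁻ x, h x ∂shiftAverage F ν = (F.card : ℝ≥0∞)⁻¹ * ∑ f ∈ F, ∫⁻ x, h x ∂ν.map (shift f) := by
  simp [shiftAverage, lintegral_smul_measure, lintegral_finsetSum_measure]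

lemma shiftAverage_apply_le {F : Finset G} (hF : F.Nonempty) {ν : Measure (G → ℕ)}
    {B : Set (G → ℕ)} {c : ℝ≥0∞} (h : ∀ f ∈ F, ν.map (shift f) B ≤ c) :
    shiftAverage F ν B ≤ c := by
  have hc : (F.card : ℝ≥0∞) ≠ 0 := by simpa using hF.ne_empty
  simp only [shiftAverage, Measure.smul_apply, Measure.finsetSum_apply, smul_eq_mul]
  calc (F.card : ℝ≥0∞)⁻¹ * ∑ f ∈ F, ν.map (shift f) B
      ≤ (F.card : ℝ≥0∞)⁻¹ * (F.card * c) := by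
        gcongr
        simpa using Finset.sum_le_card_nsmul F _ c h
    _ = c := by rw [← mul_assoc, ENNReal.inv_mul_cancel hc (by simp), one_mul]

lemma isProbabilityMeasure_shiftAverage {F : Finset G} (hF : F.Nonempty)
    (ν : Measure (G → ℕ)) [IsProbabilityMeasure ν] :
    IsProbabilityMeasure (shiftAverage F ν) := by
  have hc : (F.card : ℝ≥0∞) ≠ 0 := by simpa using hF.ne_empty
  have h : ∀ f, ν.map (shift f) Set.univ = 1 := fun f => by
    rw [Measure.map_apply (measurable_shift f) MeasurableSet.univ]
    simp
  exact ⟨by simp [shiftAverage, h, ENNReal.inv_mul_cancel hc]⟩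

lemma integral_shiftAverage (F : Finset G) (ν : Measure (G → ℕ)) [IsProbabilityMeasure ν]
    [Countable G] (h : BoundedContinuousFunction (G → ℕ) ℝ) :
    ∫ x, h x ∂shiftAverage F ν = (F.card : ℝ)⁻¹ * ∑ f ∈ F, ∫ x, h (shift f x) ∂ν := by
  have hp : ∀ f, IsProbabilityMeasure (ν.map (shift f)) := fun f =>
    Measure.isProbabilityMeasure_map (measurable_shift f).aemeasurable
  rw [shiftAverage, integral_smul_measure, integral_finsetSum_measure fun f _ =>
    h.integrable (ν.map (shift f))]
  simp only [ENNReal.toReal_inv, ENNReal.toReal_natCast, smul_eq_mul]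
  congr 1
  refine Finset.sum_congr rfl fun f _ => ?_
  exact integral_map (measurable_shift f).aemeasurable
    h.continuous.measurable.aestronglyMeasurable

/-- The sums over `gF` and `F` cancel on the overlap. The remainders `gF \ F` and `F \ gF` have
equal size, and the first lies in `KF ∆ F`. -/
lemma abs_sum_sub_sum_le [DecidableEq G] {F : Finset G} {g : G} {K : Finset G} (hg : g ∈ K)
    {δ M : ℝ} (hF : ((symmDiff (K * F) F).card : ℝ) ≤ δ * F.card) {a : G → ℝ}
    (ha : ∀ f, |a f| ≤ M) :
    |∑ f ∈ F, a (g * f) - ∑ f ∈ F, a f| ≤ 2 * (δ * F.card) * M := by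
  have hM : 0 ≤ M := (abs_nonneg _).trans (ha 1)
  set F' : Finset G := F.map (Equiv.mulLeft g).toEmbedding with hF'
  have hsum : ∑ f ∈ F, a (g * f) = ∑ f ∈ F', a f := by simp [hF']
  have hcard : (F' \ F).card = (F \ F').card := by
    have h1 := Finset.card_sdiff_add_card_inter F' F
    have h2 := Finset.card_sdiff_add_card_inter F F'
    rw [Finset.inter_comm] at h2
    have h3 : F'.card = F.card := by simp [hF']
    omega
  have hsub : F' \ F ⊆ symmDiff (K * F) F := by
    intro x hx
    rw [Finset.mem_sdiff] at hx
    obtain ⟨f, hf, rfl⟩ := Finset.mem_map.1 hx.1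
    exact Finset.mem_symmDiff.2 (Or.inl ⟨Finset.mul_mem_mul hg hf, hx.2⟩)
  have hle : ((F' \ F).card : ℝ) ≤ δ * F.card :=
    le_trans (by exact_mod_cast Finset.card_le_card hsub) hF
  have hb : ∀ S : Finset G, |∑ f ∈ S, a f| ≤ S.card * M := fun S =>
    (Finset.abs_sum_le_sum_abs _ _).trans (by
      simpa using Finset.sum_le_card_nsmul S (fun f => |a f|) M (fun f _ => ha f))
  rw [hsum, ← Finset.sum_sdiff_sub_sum_sdiff]
  calc |∑ f ∈ F' \ F, a f - ∑ f ∈ F \ F', a f|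
      ≤ (F' \ F).card * M + (F \ F').card * M := (abs_sub _ _).trans (add_le_add (hb _) (hb _))
    _ = 2 * (F' \ F).card * M := by rw [← hcard]; ring
    _ ≤ 2 * (δ * F.card) * M := by gcongr

/-- Exchanging `a` and `0` at `g` writes this probability as the integral of a density over `{x g =
0}`. The cocycle bound for one site controls the density, uniformly in `g` and `μ`. -/
lemma IsRegularPotential.measure_site_le {φ : (G → ℕ) → ℝ} {D V : ℝ} {μ : Measure (G → ℕ)}
    (hφ : IsRegularPotential φ D V) [IsProbabilityMeasure μ] {g : G}
    (h : IsConformalOn φ {g} μ) (a : ℕ) :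
    μ {x | x g = a} ≤ ENNReal.ofReal (Real.exp (2 * D + V - φ fun _ => 0)) *
      ENNReal.ofReal (Real.exp (φ fun _ => a)) := by
  have hcyl : ∀ b, cyl ({g} : Finset G) (fun _ => b) = {x | x g = b} := fun b => by
    ext x; simp [cyl]
  have key := h _ (Finset.insert_nonempty _ _) _
    (swapSites_mem_coordPerms {g} (fun _ => a) (fun _ => 0))
    ((cyl {g} fun _ => 0).indicator 1) (measurable_one.indicator (measurableSet_cyl _ _))
  have hl : ∀ x, (cyl ({g} : Finset G) fun _ => 0).indicator (1 : (G → ℕ) → ℝ≥0∞)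
      (swapSites {g} (fun _ => a) (fun _ => 0) x) =
      (cyl ({g} : Finset G) fun _ => a).indicator 1 x := fun x => by
    by_cases hx : x ∈ cyl ({g} : Finset G) fun _ => a
    · rw [Set.indicator_of_mem hx, Set.indicator_of_mem (swapSites_mem_cyl_iff.2 hx)]
      rfl
    · rw [Set.indicator_of_notMem hx,
        Set.indicator_of_notMem fun hc => hx (swapSites_mem_cyl_iff.1 hc)]
  simp only [hl] at key
  rw [lintegral_indicator_one (measurableSet_cyl _ _), hcyl a] at key
  rw [key, ← ENNReal.ofReal_mul (Real.exp_pos _).le, ← Real.exp_add]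
  calc _ ≤ ∫⁻ _, ENNReal.ofReal
        (Real.exp (2 * D + V - φ (fun _ => 0) + φ fun _ => a)) ∂μ := ?_
    _ = _ := by simp
  refine lintegral_mono fun x => ?_
  by_cases hx : x ∈ cyl ({g} : Finset G) fun _ => 0
  · rw [Set.indicator_of_mem hx, Pi.one_apply, one_mul, swapSites_symm,
      swapSites_apply_of_mem_cyl hx]
    refine ENNReal.ofReal_le_ofReal (Real.exp_le_exp.2 ?_)
    have := hφ.cocycle_le (K := {g}) (y := splice {g} (fun _ => a) x) (z := x)
      fun i hi => splice_of_notMem _ _ hi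
    have hx' : x g = 0 := by simpa [cyl] using hx
    simp only [Finset.sum_singleton, Finset.card_singleton, hx',
      splice_of_mem _ _ (Finset.mem_singleton_self g)] at this
    push_cast at this
    linarith
  · simp [hx]

end Average

variable {G : Type*} [Group G] [Countable G] {φ : (G → ℕ) → ℝ} {D V : ℝ} {K : Finset G}
  {μ : Measure (G → ℕ)}

/-- Conjugating `τ` by the shift moves its sites from `K` to `K g` and preserves the cocycle. -/
lemma IsConformalOn.map_shift (hφ : IsRegularPotential φ D V) {g : G}
    (h : open Classical in IsConformalOn φ (K * {g}) μ) :
    IsConformalOn φ K (μ.map (shift g)) := by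
  classical
  intro A hA τ hτ f hf
  let s : (G → ℕ) ≃ (G → ℕ) := ⟨shift g, shift g⁻¹, fun x => by simp [shift_shift, shift_one],
    fun x => by simp [shift_shift, shift_one]⟩
  have hs : ∀ x, s x = shift g x := fun _ => rfl
  have hτ' : (s.trans τ).trans s.symm ∈ coordPerms (K * {g}) A := by
    obtain ⟨σ, hσ, hx⟩ := hτ
    have hmem : ∀ k, k ∈ K * {g} ↔ k * g⁻¹ ∈ K := fun k => by
      simp [Finset.mem_mul, ← eq_mul_inv_iff_mul_eq]
    have happ : ∀ x k, (s.trans τ).trans s.symm x k = τ (shift g x) (k * g⁻¹) := fun _ _ => rfl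
    refine ⟨fun k => σ (k * g⁻¹), fun k hk => hσ _ ((hmem k).1 hk), fun x =>
      ⟨fun k hk => ?_, fun k hk => ?_⟩⟩
    · rw [happ, (hx _).1 _ ((hmem k).1 hk)]
      simp [shift]
    · rw [happ, (hx _).2 _ (fun hc => hk ((hmem k).2 hc))]
      simp [shift]
  have hfs : Measurable fun x => f (s x) := hf.comp (measurable_shift g)
  have key := h A hA _ hτ' _ hfs
  rw [lintegral_map (f := fun x => f (τ x)) (hf.comp (continuous_of_mem_coordPerms hτ).measurable)
    (measurable_shift g), lintegral_map
    (f := fun x => f x * ENNReal.ofReal (Real.exp (cocycle φ (τ.symm x) x)))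
    (hf.mul (hφ.measurable_density hτ)) (measurable_shift g)]
  simp only [Equiv.trans_apply, Equiv.apply_symm_apply] at key
  refine key.trans (lintegral_congr fun x => ?_)
  have hc : cocycle φ (((s.trans τ).trans s.symm).symm x) x =
      cocycle φ (τ.symm (shift g x)) (shift g x) := by
    rw [← cocycle_shift φ g]
    congr 1
    exact s.apply_symm_apply _
  rw [hc, hs]

lemma isConformalOn_shiftAverage (hφ : IsRegularPotential φ D V) {F : Finset G}
    (h : open Classical in ∀ f ∈ F, IsConformalOn φ (K * {f}) μ) :
    IsConformalOn φ K (shiftAverage F μ) := by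
  intro A hA τ hτ f hf
  rw [lintegral_shiftAverage, lintegral_shiftAverage]
  congr 1
  exact Finset.sum_congr rfl fun g hg => (h g hg).map_shift hφ A hA τ hτ f hf

namespace IsRegularPotential

lemma isConformalOn_gibbsKernel (hφ : IsRegularPotential φ D V) {H : Finset G} (hKH : K ⊆ H)
    (x : G → ℕ) : IsConformalOn φ K (gibbsKernel φ H x) :=
  fun A _ _ hτ _ hf => hφ.lintegral_gibbsKernel_comp (coordPerms_mono hKH A hτ) x hf

/-- The extra term covers sites outside `H`, which carry the boundary symbol `0`. -/
lemma gibbsKernel_site_le (hφ : IsRegularPotential φ D V) (H : Finset G) (g : G) (a : ℕ) :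
    gibbsKernel φ H 0 {x | x g = a} ≤ ENNReal.ofReal (Real.exp (2 * D + V - φ fun _ => 0)) *
      ENNReal.ofReal (Real.exp (φ fun _ => a)) + if a = 0 then 1 else 0 := by
  have := hφ.isProbabilityMeasure_gibbsKernel H 0
  by_cases ha : a = 0
  · simpa [ha] using prob_le_one.trans le_add_self
  by_cases hg : g ∈ H
  · exact (hφ.measure_site_le (hφ.isConformalOn_gibbsKernel (by simpa using hg) 0) a).trans
      le_self_add
  · have hm : MeasurableSet {x : G → ℕ | x g = a} :=
      measurableSet_eq_fun (measurable_pi_apply g) measurable_const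
    rw [gibbsKernel_apply φ H 0 hm]
    refine le_of_eq_of_le (ENNReal.tsum_eq_zero.2 fun w => ?_) zero_le
    simp [splice_of_notMem _ _ hg, Ne.symm ha]

end IsRegularPotential

end TightnessAndAveraging

/-! ### Weak limits and the invariant Gibbs measure. -/

section Existence

/-- By Prokhorov the closure of the sequence is compact; a limit along an ultrafilter avoids
extracting subsequences. -/
lemma exists_tendsto_of_forall_site {G : Type*} [Countable G] {t : ℕ → ℝ≥0∞} (ht : ∑' a, t a ≠ ∞)
    {P : ℕ → ProbabilityMeasure (G → ℕ)}
    (hP : ∀ n g a, (P n : Measure (G → ℕ)) {x | x g = a} ≤ t a) :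
    ∃ (U : Ultrafilter ℕ) (Q : ProbabilityMeasure (G → ℕ)), (U : Filter ℕ) ≤ atTop ∧
      Tendsto P U (𝓝 Q) := by
  have htight : IsTightMeasureSet
      {((μ : ProbabilityMeasure (G → ℕ)) : Measure (G → ℕ)) | μ ∈ Set.range P} := by
    refine isTightMeasureSet_of_forall_site ht ?_
    rintro _ ⟨_, ⟨n, rfl⟩, rfl⟩
    exact hP n
  obtain ⟨Q, -, hQ⟩ := (isCompact_closure_of_isTightMeasureSet htight).ultrafilter_le_nhds
    ((hyperfilter ℕ).map P) (by
      rw [le_principal_iff]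
      exact Filter.mem_of_superset (Filter.range_mem_map (f := (hyperfilter ℕ : Filter ℕ)))
        subset_closure)
  exact ⟨hyperfilter ℕ, Q, Nat.hyperfilter_le_atTop, hQ⟩

variable {G : Type*} [Group G] [Countable G] {φ : (G → ℕ) → ℝ} {D V : ℝ} {K : Finset G}

/-- Metrizability of the countable product lets bounded continuous functions determine finite
measures. -/
instance instHasOuterApproxClosedConfig : HasOuterApproxClosed (G → ℕ) :=
  letI := TopologicalSpace.metrizableSpaceMetric (G → ℕ)
  inferInstance

/-- For bounded continuous `f`, both `f ∘ τ` and `f` times the density are bounded continuous, so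
the identity passes to the limit. -/
lemma isConformalOn_of_tendsto (hφ : IsRegularPotential φ D V) {ι : Type*} {L : Filter ι}
    [L.NeBot] {P : ι → ProbabilityMeasure (G → ℕ)} {Q : ProbabilityMeasure (G → ℕ)}
    (hP : Tendsto P L (𝓝 Q)) (h : ∀ᶠ i in L, IsConformalOn φ K (P i : Measure (G → ℕ))) :
    IsConformalOn φ K (Q : Measure (G → ℕ)) := by
  intro A hA τ hτ
  have hτm := (continuous_of_mem_coordPerms hτ).measurable
  have hmap : (Q : Measure (G → ℕ)).map τ = (Q : Measure (G → ℕ)).withDensity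
      fun x => ENNReal.ofReal (Real.exp (cocycle φ (τ.symm x) x)) := by
    have : IsProbabilityMeasure ((Q : Measure (G → ℕ)).map τ) :=
      Measure.isProbabilityMeasure_map hτm.aemeasurable
    refine ext_of_forall_lintegral_eq_of_IsFiniteMeasure fun f => ?_
    have hfm : Measurable fun x => (f x : ℝ≥0∞) := f.continuous.measurable.coe_nnreal_ennreal
    rw [lintegral_map hfm hτm,
      lintegral_withDensity_eq_lintegral_mul _ (hφ.measurable_density hτ) hfm]
    obtain ⟨C, hC⟩ := hφ.exists_abs_cocycle_le (S := id)
      (fun x _ hi => apply_eq_of_mem_coordPerms (symm_mem_coordPerms hτ) x hi)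
      (hφ.abs_sub_le_of_coordPerms (symm_mem_coordPerms hτ))
    let ρ : BoundedContinuousFunction (G → ℕ) NNReal := BoundedContinuousFunction.mkOfBound
      ⟨fun x => Real.toNNReal (Real.exp (cocycle φ (τ.symm x) x)), continuous_real_toNNReal.comp
        (Real.continuous_exp.comp (hφ.continuous_cocycle_coordPerms hτ))⟩ (Real.exp C)
      fun x y => by
        have hb : ∀ x, (Real.toNNReal (Real.exp (cocycle φ (τ.symm x) x)) : ℝ) ≤ Real.exp C :=
          fun x => by
            rw [Real.coe_toNNReal _ (Real.exp_pos _).le]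
            exact Real.exp_le_exp.2 ((le_abs_self _).trans (hC x))
        exact abs_sub_le_of_nonneg_of_le (NNReal.coe_nonneg _) (hb x) (NNReal.coe_nonneg _) (hb y)
    let fτ : BoundedContinuousFunction (G → ℕ) NNReal :=
      f.compContinuous ⟨τ, continuous_of_mem_coordPerms hτ⟩
    rw [ProbabilityMeasure.tendsto_iff_forall_lintegral_tendsto] at hP
    have h2 := hP (ρ * f)
    refine tendsto_nhds_unique (hP fτ) ((h2.congr' ?_).trans_eq ?_)
    · filter_upwards [h] with i hi
      refine Eq.trans (lintegral_congr fun x => ?_) (hi A hA τ hτ _ hfm).symm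
      rw [BoundedContinuousFunction.mul_apply, ENNReal.coe_mul, mul_comm]
      rfl
    · rfl
  intro f hf
  rw [← lintegral_map hf hτm, hmap,
    lintegral_withDensity_eq_lintegral_mul _ (hφ.measurable_density hτ) hf]
  exact lintegral_congr fun x => mul_comm _ _

lemma isShiftInvariant_of_tendsto {L : Filter ℕ} [L.NeBot] (hL : L ≤ atTop)
    {P : ℕ → ProbabilityMeasure (G → ℕ)} {Q : ProbabilityMeasure (G → ℕ)}
    (hP : Tendsto P L (𝓝 Q)) {K F : ℕ → Finset G} {ν : ℕ → Measure (G → ℕ)}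
    [∀ n, IsProbabilityMeasure (ν n)]
    (hPF : ∀ n, (P n : Measure (G → ℕ)) = shiftAverage (F n) (ν n))
    (hF : ∀ n, (F n).Nonempty)
    (hK : ∀ g, ∀ᶠ n in atTop, g ∈ K n) {δ : ℕ → ℝ} (hδ : Tendsto δ atTop (𝓝 0))
    (hinv : ∀ n, IsInvariantSet (K n) (F n) (δ n)) :
    IsShiftInvariant (Q : Measure (G → ℕ)) := by
  classical
  intro g
  have : IsProbabilityMeasure ((Q : Measure (G → ℕ)).map (shift g)) :=
    Measure.isProbabilityMeasure_map (measurable_shift g).aemeasurable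
  refine ext_of_forall_integral_eq_of_IsFiniteMeasure fun f => ?_
  rw [integral_map (measurable_shift g).aemeasurable
    f.continuous.measurable.aestronglyMeasurable]
  rw [ProbabilityMeasure.tendsto_iff_forall_integral_tendsto] at hP
  let fg : BoundedContinuousFunction (G → ℕ) ℝ := f.compContinuous ⟨shift g, continuous_shift g⟩
  rw [← sub_eq_zero]
  refine tendsto_nhds_unique ((hP fg).sub (hP f)) (Tendsto.mono_left ?_ hL)
  refine squeeze_zero_norm' (a := fun n => 2 * δ n * ‖f‖) ?_
    (by simpa using (hδ.const_mul 2).mul_const ‖f‖)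
  filter_upwards [hK g] with n hn
  have hc : (0 : ℝ) < (F n).card := by exact_mod_cast (hF n).card_pos
  have ha : ∀ h, |∫ x, f (shift h x) ∂ν n| ≤ ‖f‖ := fun h =>
    (norm_integral_le_of_norm_le_const (ae_of_all _ fun x => f.norm_coe_le_norm _)).trans
      (by simp)
  have hle : ((symmDiff (K n * F n) (F n)).card : ℝ) ≤ δ n * (F n).card := by
    have := (hinv n).le
    convert this
  have key := abs_sum_sub_sum_le hn hle ha
  rw [hPF, integral_shiftAverage, integral_shiftAverage, ← mul_sub, norm_mul, Real.norm_eq_abs,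
    Real.norm_eq_abs, abs_of_pos (inv_pos.2 hc), inv_mul_le_iff₀ hc]
  refine le_of_eq_of_le ?_ (key.trans_eq (by ring))
  congr 2
  refine Finset.sum_congr rfl fun h _ => ?_
  refine integral_congr_ae (ae_of_all _ fun x => ?_)
  simp [fg, shift_shift]

theorem exists_isShiftInvariant_isConformalOn (hG : IsAmenable G)
    (hφ : IsRegularPotential φ D V) {E : ℕ → Finset G} (hE : IsExhaustion E) :
    ∃ μ : Measure (G → ℕ), IsProbabilityMeasure μ ∧ IsShiftInvariant μ ∧
      ∀ K, IsConformalOn φ K μ := by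
  classical
  have hne : ∀ n, (E (n + 1)).Nonempty := fun n =>
    ⟨1, hE.mono (show 1 ≤ n + 1 by omega) (by simp [hE.one])⟩
  choose F hF hinv using fun n : ℕ => hG (E (n + 1)) (hne n) (1 / ((n : ℝ) + 1)) (by positivity)
  -- For `K ⊆ E_{n+1}` and `f ∈ F_n` the region contains `K f`, so the translate by `f` is conformal
  -- on `K`.
  let ν : ℕ → Measure (G → ℕ) := fun n => gibbsKernel φ (E (n + 1) * F n) 0
  have hν : ∀ n, IsProbabilityMeasure (ν n) := fun n => hφ.isProbabilityMeasure_gibbsKernel _ _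
  let P : ℕ → ProbabilityMeasure (G → ℕ) := fun n =>
    ⟨shiftAverage (F n) (ν n), isProbabilityMeasure_shiftAverage (hF n) (ν n)⟩
  let t : ℕ → ℝ≥0∞ := fun a => ENNReal.ofReal (Real.exp (2 * D + V - φ fun _ => 0)) *
      ENNReal.ofReal (Real.exp (φ fun _ => a)) + if a = 0 then 1 else 0
  have ht : ∑' a, t a ≠ ∞ := by
    rw [ENNReal.tsum_add, ENNReal.tsum_mul_left, tsum_ite_eq]
    exact ENNReal.add_ne_top.2 ⟨ENNReal.mul_ne_top ENNReal.ofReal_ne_top hφ.tsum_exp.ne, by simp⟩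
  have hsite : ∀ n g a, (P n : Measure (G → ℕ)) {x | x g = a} ≤ t a := by
    intro n g a
    refine shiftAverage_apply_le (hF n) fun f _ => ?_
    rw [Measure.map_apply (measurable_shift f)
      (measurableSet_eq_fun (measurable_pi_apply g) measurable_const)]
    exact hφ.gibbsKernel_site_le _ (g * f) a
  obtain ⟨U, Q, hU, hQ⟩ := exists_tendsto_of_forall_site ht hsite
  have hEU : Tendsto (fun n => E (n + 1)) atTop atTop :=
    hE.tendsto_atTop.comp (tendsto_add_atTop_nat 1)
  refine ⟨Q, inferInstance, isShiftInvariant_of_tendsto hU hQ (fun _ => rfl) hF (fun g => ?_)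
    tendsto_one_div_add_atTop_nhds_zero_nat hinv, fun K => ?_⟩
  · filter_upwards [hEU.eventually_ge_atTop {g}] with n hn
    exact hn (Finset.mem_singleton_self g)
  · refine isConformalOn_of_tendsto hφ hQ (hU ?_)
    filter_upwards [hEU.eventually_ge_atTop K] with n hn
    refine isConformalOn_shiftAverage hφ fun f hf => ?_
    convert hφ.isConformalOn_gibbsKernel (Finset.mul_subset_mul hn
      (Finset.singleton_subset_iff.2 hf)) 0

end Existence

end GibbsShift

theorem mainTheorem5 {G : Type*} [Group G] [Countable G] (hG : GibbsShift.IsAmenable G)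
    (E : ℕ → Finset G) (hE : GibbsShift.IsExhaustion E)
    (φ : (G → ℕ) → ℝ) (hφ : GibbsShift.IsExpSummable φ)
    (hV : GibbsShift.HasSummableVariation E φ) :
    (∃ μ : Measure (G → ℕ), IsProbabilityMeasure μ ∧
      GibbsShift.IsShiftInvariant μ ∧ GibbsShift.IsDLR E φ μ) ∧
    ∀ μ : Measure (G → ℕ), IsProbabilityMeasure μ →
      (GibbsShift.IsDLR E φ μ ↔ GibbsShift.IsConformal E φ μ) := by
  obtain ⟨D, V, hreg⟩ := GibbsShift.exists_isRegularPotential hE hφ hV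
  refine ⟨?_, fun μ hμ => ?_⟩
  · obtain ⟨μ, hμ, hinv, hconf⟩ :=
      GibbsShift.exists_isShiftInvariant_isConformalOn hG hreg hE
    exact ⟨μ, hμ, hinv, (hreg.isDLR_iff hE).2 fun K _ =>
      hreg.isGibbsInvariantOn_of_isConformalOn (hconf K)⟩
  · rw [hreg.isDLR_iff hE, hreg.isConformal_iff hE]
    exact forall₂_congr fun K _ => ⟨hreg.isConformalOn_of_isGibbsInvariantOn,
      hreg.isGibbsInvariantOn_of_isConformalOn⟩
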